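/- Conventions (Type-2 theory of effectivity). Let $\Sigma$ be a finite alphabet with $0,1\in\Sigma$, $\Sigma^*$ the set of finite words and $\Sigma^\omega$ the set of infinite sequences. Put $\iota(a_1\ldots a_k)=110a_10a_2\ldots 0a_k011$ and $\langle u_1,\ldots,u_n\rangle=\iota(u_1)\cdots\iota(u_n)$ for words; $\langle p_1,\ldots,p_n\rangle=p_1(0)\ldots p_n(0)p_1(1)\ldots p_n(1)\ldots$ for sequences; and $\langle p_0,p_1,\ldots\rangle\langle i,j\rangle=p_i(j)$ with the Cantor pairing $\langle i,j\rangle=(i+j)(i+j+1)/2+j$. Write $u\ll p$ if $\iota(u)$ is a subword of the word or sequence $p$. Computability of partial functions on words and sequences is computability by Type-2 machines. A multi-representation $\gamma$ of $M$ relates sequences $p$ (names) to elements $x$ of $M$, written $x\in\gamma(p)$; a partial function $g$ on $\Sigma^\omega$ realizes a partial function $f$ from $M$ to $M'$ with respect to $(\gamma,\gamma')$ if $f(x)\in\gamma'(g(p))$ whenever $x\in\gamma(p)$ and $x\in\mathrm{dom}(f)$, and $f$ is $(\gamma,\gamma')$-computable if some computable $g$ realizes it. A name of $(x_1,\ldots,x_n)$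 under $[\gamma_1,\ldots,\gamma_n]$ is a sequence $\langle p_1,\ldots,p_n\rangle$ with $x_i\in\gamma_i(p_i)$ for all $i$; similarly for $[\gamma_1,\gamma_2,\ldots]$ and $\langle p_1,p_2,\ldots\rangle$. An effective topological space $\mathbf X=(X,\tau,\beta,\nu)$ is a $T_0$-space $(X,\tau)$ with a partial function $\nu$ from $\Sigma^*$ onto a base $\beta$ of $\tau$. A set $S\subseteq \mathrm{dom}(\nu)^3$ realizes intersection if $\nu(u)\cap\nu(v)=\bigcup\{\nu(w)\mid(u,v,w)\in S\}$ for all $u,v\in\mathrm{dom}(\nu)$. The space is computable if $\mathrm{dom}(\nu)$ is recursive and some r.e. $S$ realizes intersection. $\mathbf X\in\Delta\langle r,s\rangle$ means that $r$ enumerates the graph of the characteristic function of $\mathrm{dom}(\nu)$ and $s$ enumerates some $S$ that realizes intersection; a sequence $(\mathbf X_1,\mathbf X_2,\ldots)$ is $(\nu_{\mathbb N},\Delta)$-computable if a $\Delta$-name of $\mathbf X_n$ can be computed from the word $0^n$, for all $n\ge1$. For $w\in\Sigma^*$ let $w\in\mathrm{dom}(\nu^{\rm fs})$ iff $v\in\mathrm{dom}(\nu)$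 for all $v\ll w$, and then $\nu^{\rm fs}(w)=\{\nu(v)\mid v\ll w\}$. For compact $K\subseteq X$, $K\in\kappa_{\mathbf X}(p)$ iff for all $w\in\Sigma^*$: $w\ll p$ iff ($w\in\mathrm{dom}(\nu^{\rm fs})$ and $K\subseteq\bigcup\nu^{\rm fs}(w)$); and $K\in\tilde\kappa_{\mathbf X}(p)$ iff for all $w$: $w\ll p$ iff ($w\in\mathrm{dom}(\nu^{\rm fs})$, $K\subseteq\bigcup\nu^{\rm fs}(w)$ and $\nu(v)\cap K\ne\emptyset$ for all $v\ll w$). The product $\mathbf X_1\times\mathbf X_2$ is the product space with the base notation $\langle u_1,u_2\rangle\mapsto\nu_1(u_1)\times\nu_2(u_2)$ ($u_i\in\mathrm{dom}(\nu_i)$); $\mathbf X_1\times\cdots\times\mathbf X_n$ is defined inductively as $(\ldots(\mathbf X_1\times\mathbf X_2)\times\cdots)\times\mathbf X_n$; and $\mathbf X_1\times\mathbf X_2\times\cdots$ is the countable product space with the base notation $\langle u_1,\ldots,u_k\rangle\mapsto\nu_1(u_1)\times\cdots\times\nu_k(u_k)\times X_{k+1}\times X_{k+2}\times\cdots$ ($k\ge1$,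 $u_i\in\mathrm{dom}(\nu_i)$). Corollary. Let $\mathbf X_1,\mathbf X_2$ be computable topological spaces in part (1), and let $(\mathbf X_1,\mathbf X_2,\ldots)$ be a $(\nu_{\mathbb N},\Delta)$-computable sequence of topological spaces in parts (2) and (3). For compact sets $K_i\subseteq X_i$: 1. The function $(K_1,K_2)\mapsto K_1\times K_2$ is $([\kappa_{\mathbf X_1},\kappa_{\mathbf X_2}],\kappa_{\mathbf X_1\times\mathbf X_2})$-computable. 2. There is a computable function $f$ such that for every $n\ge1$ the function $q\mapsto f(0^n,q)$ realizes $(K_1,\ldots,K_n)\mapsto K_1\times\cdots\times K_n$ with respect to $([\kappa_{\mathbf X_1},\ldots,\kappa_{\mathbf X_n}],\kappa_{\mathbf X_1\times\cdots\times\mathbf X_n})$. 3. The function $(K_1,K_2,\ldots)\mapsto K_1\times K_2\times\cdots$ is $([\kappa_{\mathbf X_1},\kappa_{\mathbf X_2},\ldots],\kappa_{\mathbf X_1\times\mathbf X_2\times\cdots})$-computable. Statements 1 and 2 hold likewise with $\tilde\kappa$ in place of $\kappa$ throughout. Statement 3 holds likewise with $\tilde\kappa$ in place of $\kappa$ for the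 function restricted to the sequences $(K_1,K_2,\ldots)$ of non-empty compact sets. -/

import Mathlib

open TopologicalSpace

universe u v w

/-! ## Words, sequences and tupling -/

/-- The alphabet: an arbitrary finite alphabet with two distinguished distinct symbols `0`, `1`. -/
abbrev Letter (k : ℕ) : Type := Fin (k + 2)

/-- Finite words over the alphabet. -/
abbrev Word (k : ℕ) : Type := List (Letter k)

/-- Infinite sequences over the alphabet. -/
abbrev OmegaWord (k : ℕ) : Type := ℕ → Letter k

section

variable {k : ℕ}

/-- The wrapping function `ι(a₁a₂…aₙ) = 11 0a₁ 0a₂ … 0aₙ 011`. -/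
def iota (w : Word k) : Word k :=
  [1, 1] ++ (w.flatMap (fun a => [0, a]) ++ [0, 1, 1])

/-- Tupling of words: `⟨u₁,…,uₙ⟩ = ι(u₁)…ι(uₙ)`. -/
def tuple (us : List (Word k)) : Word k := us.flatMap iota

/-- `v ≪ w` for words: `ι(v)` is a subword of `w`. -/
def InWord (v w : Word k) : Prop := iota v <:+: w

/-- `v ≪ p` for sequences: `ι(v)` is a subword of `p`. -/
def InSeq (v : Word k) (p : OmegaWord k) : Prop :=
  ∃ n : ℕ, ∀ (i : ℕ) (h : i < (iota v).length), p (n + i) = (iota v)[i]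

/-- The word `0ⁿ`, the name of the number `n` under the notation `ν_ℕ`. -/
def unary (n : ℕ) : Word k := List.replicate n 0

/-- Finite tupling of sequences (interleaving):
`⟨p₁,…,pₙ⟩ = p₁(0)…pₙ(0) p₁(1)…pₙ(1) p₁(2)…`, for `n + 1` sequences `p 0, …, p n`. -/
def seqTuple {n : ℕ} (p : Fin (n + 1) → OmegaWord k) : OmegaWord k :=
  fun m => p ⟨m % (n + 1), Nat.mod_lt _ n.succ_pos⟩ (m / (n + 1))

/-- The Cantor pairing function `⟨i,j⟩ = (i+j)(i+j+1)/2 + j`. -/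
def cantorPair (i j : ℕ) : ℕ := (i + j) * (i + j + 1) / 2 + j

/-- `IsSeqSeq p r` says that `r = ⟨p₀,p₁,…⟩`, where `⟨p₀,p₁,…⟩⟨i,j⟩ = pᵢ(j)`. -/
def IsSeqSeq (p : ℕ → OmegaWord k) (r : OmegaWord k) : Prop :=
  ∀ i j : ℕ, r (cantorPair i j) = p i j

/-! ## Type-2 machines -/

/-- The content of a one-way input tape; `none` is the blank symbol. -/
abbrev InTape (k : ℕ) : Type := ℕ → Option (Letter k)

/-- The input tape carrying a finite word, followed by blanks. -/
def wordTape (w : Word k) : InTape k := fun n => w[n]?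

/-- The input tape carrying an infinite sequence. -/
def seqTape (p : OmegaWord k) : InTape k := fun n => some (p n)

/-- A Type-2 machine with `m` one-way read-only input tapes and a one-way write-only output tape.
Its work storage always holds a finite object (an element of `Mem`).
In one step it inspects its storage and the symbols under the `m` input heads; from these it
computes the next storage content, which of the input heads move one cell forward,
and at most one symbol that is appended to the output. -/
structure Type2Machine (k m : ℕ) where
  Mem : Type
  [primcodable : Primcodable Mem]
  start : Mem
  step : Mem → (Fin m → Option (Letter k)) → Mem × (Fin m → Bool) × Option (Letter k)
  step_computable : Computable₂ step

namespace Type2Machine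

variable {m : ℕ}

/-- A configuration: storage, positions of the input heads, output written so far. -/
structure Config (M : Type2Machine k m) where
  mem : M.Mem
  head : Fin m → ℕ
  out : Word k

/-- The configuration after `t` steps on the input `y`. -/
def config (M : Type2Machine k m) (y : Fin m → InTape k) : ℕ → M.Config
  | 0 => ⟨M.start, fun _ => 0, []⟩
  | t + 1 =>
    let c := M.config y t
    let r := M.step c.mem (fun i => y i (c.head i))
    ⟨r.1, fun i => if r.2.1 i then c.head i + 1 else c.head i, c.out ++ r.2.2.toList⟩

/-- On the input `y` the machine computes forever and writes the infinite sequence `q`. -/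
def Computes (M : Type2Machine k m) (y : Fin m → InTape k) (q : OmegaWord k) : Prop :=
  ∀ n : ℕ, ∃ t : ℕ, (M.config y t).out[n]? = some (q n)

end Type2Machine

/-- Computability of a partial function from sequences to sequences. -/
def SeqComputable (g : OmegaWord k →. OmegaWord k) : Prop :=
  ∃ M : Type2Machine k 1, ∀ p q, q ∈ g p ↔ M.Computes ![seqTape p] q

/-- Computability of a partial function from words to sequences. -/
def WordComputable (g : Word k →. OmegaWord k) : Prop :=
  ∃ M : Type2Machine k 1, ∀ w q, q ∈ g w ↔ M.Computes ![wordTape w] q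

/-- Computability of a partial function that takes a word and a sequence to a sequence. -/
def WordSeqComputable (g : Word k → OmegaWord k →. OmegaWord k) : Prop :=
  ∃ M : Type2Machine k 2, ∀ w p q, q ∈ g w p ↔ M.Computes ![wordTape w, seqTape p] q

/-! ## Multi-representations and realization -/

/-- A multi-representation by sequences, as a naming relation: `γ p x` means `x ∈ γ(p)`. -/
abbrev MultiRep (k : ℕ) (M : Type*) : Type _ := OmegaWord k → M → Prop

section
variable {M M' : Type*}

/-- The partial function `g` on names realizes the partial function `f`
with respect to `γ` and `γ'`. -/
def Realizes (g : OmegaWord k →. OmegaWord k) (γ : MultiRep k M) (γ' : MultiRep k M') (f : M →. M') : Prop :=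
  ∀ p x, γ p x → ∀ y ∈ f x, ∃ q ∈ g p, γ' q y

/-- `f` is `(γ,γ')`-computable. -/
def RepComputable (γ : MultiRep k M) (γ' : MultiRep k M') (f : M →. M') : Prop :=
  ∃ g : OmegaWord k →. OmegaWord k, SeqComputable g ∧ Realizes g γ γ' f

/-- The multi-representation `[γ₁,γ₂]` of a binary product. -/
def MultiRep.prod (γ : MultiRep k M) (γ' : MultiRep k M') : MultiRep k (M × M') :=
  fun r x => ∃ p p' : OmegaWord k, r = seqTuple ![p, p'] ∧ γ p x.1 ∧ γ' p' x.2

end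

/-- The multi-representation `[γ₁,…,γₙ]` of a finite product. -/
def MultiRep.finProd {n : ℕ} {M : Fin (n + 1) → Type*} (γ : ∀ i, MultiRep k (M i)) :
    MultiRep k (∀ i, M i) :=
  fun r x => ∃ p : Fin (n + 1) → OmegaWord k, r = seqTuple p ∧ ∀ i, γ i (p i) (x i)

/-- The multi-representation `[γ₁,γ₂,…]` of a countable product. -/
def MultiRep.countProd {M : ℕ → Type*} (γ : ∀ i, MultiRep k (M i)) : MultiRep k (∀ i, M i) :=
  fun r x => ∃ p : ℕ → OmegaWord k, IsSeqSeq p r ∧ ∀ i, γ i (p i) (x i)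

/-! ## Injectivity of tupling -/

theorem iota_append_inj : ∀ {a b s t : Word k}, iota a ++ s = iota b ++ t → a = b ∧ s = t := by
  suffices h : ∀ a b s t : Word k,
      a.flatMap (fun c => [0, c]) ++ 0 :: 1 :: 1 :: s
        = b.flatMap (fun c => [0, c]) ++ 0 :: 1 :: 1 :: t → a = b ∧ s = t by
    intro a b s t hab
    refine h a b s t ?_
    simpa [iota] using hab
  intro a
  induction a with
  | nil =>
    intro b s t hab
    cases b with
    | nil => simpa using hab
    | cons c b => cases b <;> simp at hab
  | cons c a ih =>
    intro b s t hab
    cases b with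
    | nil => cases a <;> simp at hab
    | cons d b =>
      simp only [List.flatMap_cons, List.cons_append, List.nil_append, List.cons.injEq,
        true_and] at hab
      obtain ⟨h1, h2⟩ := ih b s t hab.2
      exact ⟨by rw [hab.1, h1], h2⟩

theorem tuple_injective : Function.Injective (tuple : List (Word k) → Word k) := by
  intro a
  induction a with
  | nil =>
    intro b h
    cases b with
    | nil => rfl
    | cons c b => simp [tuple, iota] at h
  | cons c a ih =>
    intro b h
    cases b with
    | nil => simp [tuple, iota] at h
    | cons d b =>
      simp only [tuple, List.flatMap_cons] at h
      obtain ⟨h1, h2⟩ := iota_append_inj h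
      rw [h1, ih h2]

/-! ## Effective topological spaces -/

/-- An effective topological space `(X,τ,β,ν)`: a `T₀` space with a partial function `ν` from
words onto a base `β` of its topology. The partial function is given by its domain `dom` and by
its values on `dom`; outside of `dom` the function `nu` has the fixed value `∅`,
so that `x ∈ nu w` includes `w ∈ dom`. The base is `β = range ν = nu '' dom`. -/
structure EffSpace (k : ℕ) : Type (u + 1) where
  carrier : Type u
  [top : TopologicalSpace carrier]
  t0 : T0Space carrier
  dom : Set (Word k)
  nu : Word k → Set carrier
  nu_outside : ∀ w, w ∉ dom → nu w = ∅
  isBasis : IsTopologicalBasis (nu '' dom)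

namespace EffSpace

instance : CoeSort (EffSpace.{u} k) (Type u) := ⟨carrier⟩

instance (X : EffSpace.{u} k) : TopologicalSpace X := X.top

theorem mem_dom (X : EffSpace.{u} k) {w : Word k} {x : X} (h : x ∈ X.nu w) : w ∈ X.dom := by
  by_contra hw
  rw [X.nu_outside w hw] at h
  exact h

/-- The set `S` of triples of words describes the intersections of base elements:
`S ⊆ dom(ν)³`, and `ν(u) ∩ ν(v) = ⋃ {ν(w) | (u,v,w) ∈ S}` for all `u, v ∈ dom(ν)`. -/
def Intersects (X : EffSpace.{u} k) (S : Set (Word k × Word k × Word k)) : Prop :=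
  (∀ a b c, (a, b, c) ∈ S → a ∈ X.dom ∧ b ∈ X.dom ∧ c ∈ X.dom) ∧
  ∀ a ∈ X.dom, ∀ b ∈ X.dom, X.nu a ∩ X.nu b = {x | ∃ c, (a, b, c) ∈ S ∧ x ∈ X.nu c}

/-- Computable topological spaces. -/
def IsComputable (X : EffSpace.{u} k) : Prop :=
  ComputablePred (fun w => w ∈ X.dom) ∧
  ∃ S : Set (Word k × Word k × Word k), REPred (fun t => t ∈ S) ∧ X.Intersects S

/-- The sequence `r` enumerates the graph of the characteristic function of `A`:
the words `w ≪ r` are the words `⟨u,0⟩` with `u ∈ A` and the words `⟨u,ε⟩` with `u ∉ A`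
(the values `1` and `0` being named by `0¹ = 0` and by `0⁰ = ε`). -/
def EnumeratesCharFun (r : OmegaWord k) (A : Set (Word k)) : Prop :=
  ∀ w, InSeq w r ↔
    ∃ a, (a ∈ A ∧ w = tuple [a, unary 1]) ∨ (a ∉ A ∧ w = tuple [a, unary 0])

/-- The sequence `s` enumerates the set `S` of triples of words. -/
def EnumeratesTriples (s : OmegaWord k) (S : Set (Word k × Word k × Word k)) : Prop :=
  ∀ w, InSeq w s ↔ ∃ a b c, (a, b, c) ∈ S ∧ w = tuple [a, b, c]

/-- The multi-representation `Δ` of the class of effective topological spaces. -/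
def Delta : MultiRep k (EffSpace.{u} k) :=
  fun t X => ∃ r s : OmegaWord k, t = seqTuple ![r, s] ∧ EnumeratesCharFun r X.dom ∧
    ∃ S : Set (Word k × Word k × Word k), EnumeratesTriples s S ∧ X.Intersects S

/-- The sequence of spaces `X₁, X₂, …` is `(ν_ℕ,Δ)`-computable: from `0ⁿ`, `n ≥ 1`, a `Δ`-name
of `Xₙ` can be computed. In Lean, `X i` is the space `X_{i+1}`. -/
def ComputableSequence (X : ℕ → EffSpace.{u} k) : Prop :=
  ∃ g : Word k →. OmegaWord k, WordComputable g ∧ ∀ i, ∃ q ∈ g (unary (i + 1)), Delta q (X i)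

/-! ### Multi-representations of the compact sets -/

/-- The word `w` is in the domain of `ν^fs`. -/
def FsDom (X : EffSpace.{u} k) (w : Word k) : Prop := ∀ a, InWord a w → a ∈ X.dom

/-- The union `⋃ ν^fs(w)` of the sets `ν(a)`, `a ≪ w`. -/
def fsUnion (X : EffSpace.{u} k) (w : Word k) : Set X := {x | ∃ a, InWord a w ∧ x ∈ X.nu a}

/-- The multi-representation `κ_X`: a name of `K` lists all finite covers of `K` by base sets. -/
def kappa (X : EffSpace.{u} k) : MultiRep k (Compacts X) :=
  fun p K => ∀ w, InSeq w p ↔ (X.FsDom w ∧ (K : Set X) ⊆ X.fsUnion w)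

/-- The multi-representation `κ̃_X`: a name of `K` lists all minimal finite covers of `K`, that is,
the finite covers by base sets each of which intersects `K`. -/
def kappaMin (X : EffSpace.{u} k) : MultiRep k (Compacts X) :=
  fun p K => ∀ w, InSeq w p ↔
    (X.FsDom w ∧ (K : Set X) ⊆ X.fsUnion w ∧ ∀ a, InWord a w → (X.nu a ∩ (K : Set X)).Nonempty)

/-! ### Products of spaces -/

/-- The set that `⟨a,b⟩` denotes in a binary product: `ν₁(a) × ν₂(b)`. -/
def prodNu (X : EffSpace.{u} k) (Y : EffSpace.{v} k) (w : Word k) : Set (X × Y) :=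
  {x | ∃ a b, w = tuple [a, b] ∧ x.1 ∈ X.nu a ∧ x.2 ∈ Y.nu b}

theorem prodNu_tuple (X : EffSpace.{u} k) (Y : EffSpace.{v} k) (a b : Word k) :
    prodNu X Y (tuple [a, b]) = X.nu a ×ˢ Y.nu b := by
  ext x
  constructor
  · rintro ⟨a', b', h, h1, h2⟩
    have h' := tuple_injective h
    simp only [List.cons.injEq, and_true] at h'
    rw [h'.1, h'.2]
    exact ⟨h1, h2⟩
  · rintro ⟨h1, h2⟩
    exact ⟨a, b, rfl, h1, h2⟩

/-- The product `X × Y` of two effective topological spaces. -/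
def prod (X : EffSpace.{u} k) (Y : EffSpace.{v} k) : EffSpace.{max u v} k where
  carrier := X × Y
  t0 := by
    have := X.t0
    have := Y.t0
    infer_instance
  dom := {w | ∃ a ∈ X.dom, ∃ b ∈ Y.dom, w = tuple [a, b]}
  nu := prodNu X Y
  nu_outside := by
    intro w hw
    ext x
    simp only [Set.mem_empty_iff_false, iff_false]
    rintro ⟨a, b, h, h1, h2⟩
    exact hw ⟨a, X.mem_dom h1, b, Y.mem_dom h2, h⟩
  isBasis := by
    have h := X.isBasis.prod Y.isBasis
    convert h using 1
    ext U
    constructor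
    · rintro ⟨w, ⟨a, ha, b, hb, rfl⟩, rfl⟩
      exact ⟨_, ⟨a, ha, rfl⟩, _, ⟨b, hb, rfl⟩, (prodNu_tuple X Y a b).symm⟩
    · rintro ⟨_, ⟨a, ha, rfl⟩, _, ⟨b, hb, rfl⟩, rfl⟩
      exact ⟨_, ⟨a, ha, b, hb, rfl⟩, prodNu_tuple X Y a b⟩

/-- The finite products `X'₁ = X₁`, `X'_{n+1} = X'_n × X_{n+1}`. In Lean, `X i` is `X_{i+1}`
and `finProd X n` is `X'_{n+1}`. -/
def finProd (X : ℕ → EffSpace.{u} k) : ℕ → EffSpace.{u} k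
  | 0 => X 0
  | n + 1 => (finProd X n).prod (X (n + 1))

/-- The set that `⟨u₁,…,uₙ⟩`, `n ≥ 1`, denotes in a countable product:
`ν₁(u₁) × … × νₙ(uₙ) × X_{n+1} × X_{n+2} × …`. -/
def countNu (X : ℕ → EffSpace.{u} k) (w : Word k) : Set (∀ i, X i) :=
  {x | ∃ us : List (Word k), us ≠ [] ∧ w = tuple us ∧
    ∀ (i : ℕ) (h : i < us.length), x i ∈ (X i).nu us[i]}

theorem countNu_tuple (X : ℕ → EffSpace.{u} k) {us : List (Word k)} (hus : us ≠ []) :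
    countNu X (tuple us) = {x | ∀ (i : ℕ) (h : i < us.length), x i ∈ (X i).nu us[i]} := by
  ext x
  constructor
  · rintro ⟨vs, -, h, h1⟩
    have h' := tuple_injective h
    subst h'
    exact h1
  · intro h
    exact ⟨us, hus, rfl, h⟩

/-- The countable product `X₁ × X₂ × …` of effective topological spaces. -/
def countProd (X : ℕ → EffSpace.{u} k) : EffSpace.{u} k where
  carrier := ∀ i, X i
  t0 := by
    have := fun i => (X i).t0
    infer_instance
  dom := {w | ∃ us : List (Word k), us ≠ [] ∧ w = tuple us ∧
    ∀ (i : ℕ) (h : i < us.length), us[i] ∈ (X i).dom}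
  nu := countNu X
  nu_outside := by
    intro w hw
    ext x
    simp only [Set.mem_empty_iff_false, iff_false]
    rintro ⟨us, h0, h1, h2⟩
    exact hw ⟨us, h0, h1, fun i h => (X i).mem_dom (h2 i h)⟩
  isBasis := by
    refine isTopologicalBasis_of_isOpen_of_nhds ?_ ?_
    · rintro _ ⟨w, ⟨us, h0, rfl, h1⟩, rfl⟩
      rw [countNu_tuple X h0]
      have : {x : ∀ i, X i | ∀ (i : ℕ) (h : i < us.length), x i ∈ (X i).nu us[i]}
          = ⋂ i : Fin us.length, (fun x : ∀ i, X i => x i) ⁻¹' (X i).nu us[i] := by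
        ext x
        simp only [Set.mem_ofPred_eq, Set.mem_iInter, Set.mem_preimage]
        exact ⟨fun h i => h i i.2, fun h i hi => h ⟨i, hi⟩⟩
      rw [this]
      refine isOpen_iInter_of_finite fun i => ?_
      exact ((X i).isBasis.isOpen ⟨_, h1 i i.2, rfl⟩).preimage (continuous_apply (i : ℕ))
    · intro x U hx hU
      obtain ⟨_, ⟨V, F, hV, rfl⟩, hxV, hVU⟩ :=
        (isTopologicalBasis_pi fun i => (X i).isBasis).exists_subset_of_mem_open hx hU
      have hex : ∀ i, ∃ a ∈ (X i).dom, x i ∈ (X i).nu a ∧ (i ∈ F → (X i).nu a = V i) := by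
        intro i
        by_cases hi : i ∈ F
        · obtain ⟨a, ha, h⟩ := hV i hi
          exact ⟨a, ha, by rw [h]; exact hxV i hi, fun _ => h⟩
        · obtain ⟨_, ⟨a, ha, rfl⟩, h, -⟩ :=
            (X i).isBasis.exists_subset_of_mem_open (Set.mem_univ (x i)) isOpen_univ
          exact ⟨a, ha, h, fun h' => absurd h' hi⟩
      choose a ha hxa haV using hex
      have h0 : (List.range (F.sup id + 1)).map a ≠ [] := by simp
      refine ⟨_, ⟨tuple ((List.range (F.sup id + 1)).map a), ⟨_, h0, rfl, ?_⟩, rfl⟩, ?_, ?_⟩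
      · intro i h
        simpa using ha i
      · rw [countNu_tuple X h0]
        intro i h
        simpa using hxa i
      · rw [countNu_tuple X h0]
        intro y hy
        refine hVU fun i hi => ?_
        have hle : i ≤ F.sup id := Finset.le_sup (f := id) hi
        have := hy i (by simp; omega)
        rw [← haV i hi]
        simpa using this

/-! ### Products of compact sets -/

/-- `(K₁,K₂) ↦ K₁ × K₂`. -/
def prodCompacts (X : EffSpace.{u} k) (Y : EffSpace.{v} k) (K : Compacts X × Compacts Y) :
    Compacts (X.prod Y) :=
  ⟨((K.1 : Set X) ×ˢ (K.2 : Set Y) : Set (X × Y)), K.1.isCompact.prod K.2.isCompact⟩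

/-- `(K₁,…,Kₙ) ↦ K₁ × … × Kₙ`; here `n + 1` factors are multiplied. -/
def finProdCompacts (X : ℕ → EffSpace.{u} k) :
    (n : ℕ) → (∀ i : Fin (n + 1), Compacts (X i)) → Compacts (finProd X n)
  | 0, K => K 0
  | n + 1, K =>
    prodCompacts (finProd X n) (X (n + 1))
      (finProdCompacts X n (fun i => K i.castSucc), K (Fin.last (n + 1)))

/-- `(K₁,K₂,…) ↦ K₁ × K₂ × …`. -/
def countProdCompacts (X : ℕ → EffSpace.{u} k) (K : ∀ i, Compacts (X i)) :
    Compacts (countProd X) :=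
  ⟨(Set.univ.pi fun i => (K i : Set (X i)) : Set (∀ i, X i)),
    isCompact_univ_pi fun i => (K i).isCompact⟩

end EffSpace

end

/-!
A point `x` leaves the trace `{a | x ∈ ν(a)}` on the base notation, and a word covers `K` iff its
entries meet the traces of all points of `K`; the traces of a product are the boxes of traces. If
`S` realizes intersection, then every triple `(a, b, c) ∈ S` witnesses `ν(c) ⊆ ν(a)` and `ν(c) ⊆
ν(b)`, and these formal inclusions generate a recursively enumerable preorder. A word `w` covers a
product iff finitely many factors have finite covers such that every tuple of entries of these
covers is formally included in an entry of `w`. This is sufficient because formal inclusions are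
inclusions, and it is necessary by compactness: each factor has covers so fine that every entry is
formally included in all the sides of entries of `w` that contain some common point. The condition
is semidecidable relative to names of the factors, so a dovetailed search lists exactly the covers
of the product, with single symbols `1` written while nothing is found.

For `κ̃` only the base elements that meet `K` are admitted as entries. Those of a product of
non-empty sets are the tuples of those of the factors, so the same search works.
-/

/-! ## Primitive recursive functions on lists -/

section PrimitiveRecursion

variable {α β γ σ : Type*} [Primcodable α] [Primcodable β] [Primcodable γ] [Primcodable σ]

attribute [fun_prop] Primrec
attribute [fun_prop] Primrec.id Primrec.const Primrec.comp Primrec.pair Primrec.fst Primrec.snd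
  Primrec.list_length Primrec.list_range Primrec.list_headI Primrec.list_tail
  Primrec.option_some Primrec.decode Primrec.not

@[fun_prop]
theorem primrec_append {f g : α → List β} (hf : Primrec f) (hg : Primrec g) :
    Primrec fun a => f a ++ g a := Primrec.list_append.comp hf hg

@[fun_prop]
theorem primrec_cons {f : α → β} {g : α → List β} (hf : Primrec f) (hg : Primrec g) :
    Primrec fun a => f a :: g a := Primrec.list_cons.comp hf hg

@[fun_prop]
theorem primrec_map {f : α → List β} {g : α → β → γ} (hf : Primrec f)
    (hg : Primrec fun p : α × β => g p.1 p.2) : Primrec fun a => (f a).map (g a) :=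
  Primrec.list_map hf hg

@[fun_prop]
theorem primrec_flatMap {f : α → List β} {g : α → β → List γ} (hf : Primrec f)
    (hg : Primrec fun p : α × β => g p.1 p.2) : Primrec fun a => (f a).flatMap (g a) :=
  Primrec.list_flatMap hf hg

@[fun_prop]
theorem primrec_foldr {f : α → List β} {g : α → σ} {h : α → β → σ → σ} (hf : Primrec f)
    (hg : Primrec g) (hh : Primrec fun p : α × β × σ => h p.1 p.2.1 p.2.2) :
    Primrec fun a => (f a).foldr (h a) (g a) :=
  Primrec.list_foldr (h := fun a p => h a p.1 p.2) hf hg hh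

@[fun_prop]
theorem primrec_foldl {f : α → List β} {g : α → σ} {h : α → σ → β → σ} (hf : Primrec f)
    (hg : Primrec g) (hh : Primrec fun p : α × σ × β => h p.1 p.2.1 p.2.2) :
    Primrec fun a => (f a).foldl (h a) (g a) :=
  Primrec.list_foldl (h := fun a p => h a p.1 p.2) hf hg hh

@[fun_prop]
theorem primrec_take {f : α → ℕ} {g : α → List β} (hf : Primrec f) (hg : Primrec g) :
    Primrec fun a => (g a).take (f a) := Primrec.list_take.comp hf hg

@[fun_prop]
theorem primrec_drop {f : α → ℕ} {g : α → List β} (hf : Primrec f) (hg : Primrec g) :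
    Primrec fun a => (g a).drop (f a) := Primrec.list_drop.comp hf hg

@[fun_prop]
theorem primrec_getElem? {f : α → ℕ} {g : α → List β} (hf : Primrec f) (hg : Primrec g) :
    Primrec fun a => (g a)[f a]? := Primrec.list_getElem?.comp hg hf

@[fun_prop]
theorem primrec_getD {f : α → Option β} {g : α → β} (hf : Primrec f) (hg : Primrec g) :
    Primrec fun a => (f a).getD (g a) := Primrec.option_getD.comp hf hg

@[fun_prop]
theorem primrec_elim {f : α → Option β} {g : α → γ} {h : α → β → γ} (hf : Primrec f)
    (hg : Primrec g) (hh : Primrec fun p : α × β => h p.1 p.2) :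
    Primrec fun a => (f a).elim (g a) (h a) :=
  (Primrec.option_casesOn hf hg hh).of_eq fun a => by cases f a <;> rfl

@[fun_prop]
theorem primrec_add {f g : α → ℕ} (hf : Primrec f) (hg : Primrec g) :
    Primrec fun a => f a + g a := Primrec.nat_add.comp hf hg

@[fun_prop]
theorem primrec_mul {f g : α → ℕ} (hf : Primrec f) (hg : Primrec g) :
    Primrec fun a => f a * g a := Primrec.nat_mul.comp hf hg

@[fun_prop]
theorem primrec_div {f g : α → ℕ} (hf : Primrec f) (hg : Primrec g) :
    Primrec fun a => f a / g a := Primrec.nat_div.comp hf hg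

@[fun_prop]
theorem primrec_unpair {f : α → ℕ} (hf : Primrec f) : Primrec fun a => (f a).unpair :=
  Primrec.unpair.comp hf

@[fun_prop]
theorem primrec_and {f g : α → Bool} (hf : Primrec f) (hg : Primrec g) :
    Primrec fun a => f a && g a := Primrec.and.comp hf hg

@[fun_prop]
theorem primrec_or {f g : α → Bool} (hf : Primrec f) (hg : Primrec g) :
    Primrec fun a => f a || g a := Primrec.or.comp hf hg

@[fun_prop]
theorem primrec_cond {c : α → Bool} {f g : α → σ} (hc : Primrec c) (hf : Primrec f)
    (hg : Primrec g) : Primrec fun a => bif c a then f a else g a := Primrec.cond hc hf hg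

@[fun_prop]
theorem primrec_decide_eq [DecidableEq β] {f g : α → β} (hf : Primrec f) (hg : Primrec g) :
    Primrec fun a => decide (f a = g a) := (Primrec.eq.comp hf hg).decide

@[fun_prop]
theorem primrec_decide_lt {f g : α → ℕ} (hf : Primrec f) (hg : Primrec g) :
    Primrec fun a => decide (f a < g a) := (Primrec.nat_lt.comp hf hg).decide

@[fun_prop]
theorem primrec_all {f : α → List β} {g : α → β → Bool} (hf : Primrec f)
    (hg : Primrec fun p : α × β => g p.1 p.2) : Primrec fun a => (f a).all (g a) := by
  have : Primrec fun a => (f a).foldr (fun b r => g a b && r) true := by fun_prop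
  refine this.of_eq fun a => ?_
  induction f a with
  | nil => rfl
  | cons b l ih => rw [List.foldr_cons, ih, List.all_cons]

@[fun_prop]
theorem primrec_any {f : α → List β} {g : α → β → Bool} (hf : Primrec f)
    (hg : Primrec fun p : α × β => g p.1 p.2) : Primrec fun a => (f a).any (g a) := by
  have : Primrec fun a => (f a).foldr (fun b r => g a b || r) false := by fun_prop
  refine this.of_eq fun a => ?_
  induction f a with
  | nil => rfl
  | cons b l ih => rw [List.foldr_cons, ih, List.any_cons]

@[fun_prop]
theorem primrec_filter {f : α → List β} {g : α → β → Bool} (hf : Primrec f)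
    (hg : Primrec fun p : α × β => g p.1 p.2) : Primrec fun a => (f a).filter (g a) := by
  have : Primrec fun a => (f a).foldr (fun b l => bif g a b then b :: l else l) [] := by fun_prop
  refine this.of_eq fun a => ?_
  induction f a with
  | nil => rfl
  | cons b l ih => rw [List.foldr_cons, ih, List.filter_cons, Bool.cond_eq_ite]

/-- Kleene's normal form: the stage `n` counts the steps of a machine that accepts `P`. -/
theorem exists_primrec_of_rePred {P : α → Prop} (hP : REPred P) :
    ∃ Q : α × ℕ → Bool, Primrec Q ∧ ∀ a, P a ↔ ∃ n, Q (a, n) := by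
  obtain ⟨c, hc⟩ := Nat.Partrec.Code.exists_code.1 hP
  refine ⟨fun p => (Nat.Partrec.Code.evaln p.2 c (Encodable.encode p.1)).isSome, ?_, fun a => ?_⟩
  · exact Primrec.option_isSome.comp (Nat.Partrec.Code.primrec_evaln.comp
      ((Primrec.snd.pair (Primrec.const c)).pair (Primrec.encode.comp Primrec.fst)))
  · have hP : P a ↔ ∃ x, x ∈ c.eval (Encodable.encode a) := by simp [hc]
    simp only [hP, Option.isSome_iff_exists, Nat.Partrec.Code.evaln_complete]
    exact exists_comm

theorem rePred_exists_of_computable {Q : α × ℕ → Bool} (hQ : Computable Q) :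
    REPred fun a => ∃ n, Q (a, n) := by
  have hfind : Partrec fun a => Nat.rfind fun n => Part.some (Q (a, n)) :=
    Partrec.rfind hQ.partrec
  refine hfind.dom_re.of_eq fun a => ?_
  exact Nat.rfind_dom.trans (by simp)

end PrimitiveRecursion

/-! ## Semidecidability relative to an oracle -/

section OracleComputation

theorem reflTransGen_iff_exists_path {γ : Type*} {r : γ → γ → Prop} {c d : γ} :
    Relation.ReflTransGen r c d ↔ ∃ l : List γ, (c :: l)[l.length]? = some d ∧
      ∀ (i : ℕ) (b' : γ), l[i]? = some b' → ∃ b, (c :: l)[i]? = some b ∧ r b b' := by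
  have hchain (l : List γ) : (c :: l).IsChain r ↔
      ∀ (i : ℕ) (b' : γ), l[i]? = some b' → ∃ b, (c :: l)[i]? = some b ∧ r b b' := by
    simp only [List.isChain_iff_getElem, List.getElem?_eq_some_iff]
    refine ⟨fun h i b' ⟨hi, hb'⟩ => ?_, fun h i hi => ?_⟩
    · have hi' : i + 1 < (c :: l).length := by simpa using hi
      exact ⟨_, ⟨by omega, rfl⟩, hb' ▸ h i hi'⟩
    · obtain ⟨b, ⟨_, rfl⟩, hr⟩ := h i _ ⟨by simpa using hi, rfl⟩
      exact hr
  have hlast (l : List γ) :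
      (c :: l)[l.length]? = some d ↔ (c :: l).getLast (List.cons_ne_nil c l) = d := by
    rw [List.getLast_eq_getElem, List.getElem?_eq_some_iff]
    simp
  simp only [← hchain, hlast]
  constructor
  · intro h
    obtain ⟨l, hl, hd⟩ := List.exists_isChain_cons_of_relationReflTransGen h
    exact ⟨l, hd, hl⟩
  · exact fun ⟨l, hd, hl⟩ => List.relationReflTransGen_of_exists_isChain_cons l hl hd

variable {α β γ : Type*}

/-- The first `n` values of `y`. -/
def history (y : ℕ → β) (n : ℕ) : List β := (List.range n).map y

theorem length_history (y : ℕ → β) (n : ℕ) : (history y n).length = n := by simp [history]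

theorem take_history (y : ℕ → β) {m n : ℕ} (h : m ≤ n) : (history y n).take m = history y m := by
  rw [history, ← List.map_take, List.take_range, min_eq_left h, history]

theorem getElem?_history (y : ℕ → β) {i n : ℕ} (h : i < n) : (history y n)[i]? = some (y i) := by
  simp [history, h]

theorem history_succ (y : ℕ → β) (n : ℕ) : history y (n + 1) = history y n ++ [y n] := by
  simp [history, List.range_succ]

variable [Primcodable α] [Primcodable β] [Primcodable γ]

/-- `P a y` is semidecidable in `a` relative to the oracle `y`: a primitive recursive test accepts
one of the finite prefixes of `y`. -/
def OracleSemidec (P : α → (ℕ → β) → Prop) : Prop :=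
  ∃ Q : α × List β → Bool, Primrec Q ∧ ∀ a y, P a y ↔ ∃ n, Q (a, history y n)

namespace OracleSemidec

variable {P P' : α → (ℕ → β) → Prop}

theorem of_iff (h : OracleSemidec P) (H : ∀ a y, P' a y ↔ P a y) : OracleSemidec P' := by
  obtain ⟨Q, hQ, h⟩ := h
  exact ⟨Q, hQ, fun a y => (H a y).trans (h a y)⟩

theorem exists_monotone (h : OracleSemidec P) : ∃ Q : α × List β → Bool, Primrec Q ∧
    (∀ a y, Monotone fun n => Q (a, history y n)) ∧ ∀ a y, P a y ↔ ∃ n, Q (a, history y n) := by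
  obtain ⟨Q, hQ, h⟩ := h
  set Q' : α × List β → Bool := fun p =>
    (List.range (p.2.length + 1)).any fun j => Q (p.1, p.2.take j)
  have hQ' (a y n) : Q' (a, history y n) ↔ ∃ j ≤ n, Q (a, history y j) := by
    simp only [Q', List.any_eq_true, List.mem_range, length_history, Nat.lt_succ_iff]
    exact exists_congr fun j => and_congr_right fun hj => by rw [take_history y hj]
  refine ⟨Q', by fun_prop, fun a y m n hmn => Bool.le_iff_imp.2 ?_, fun a y => ?_⟩
  · rw [hQ', hQ']
    exact fun ⟨j, hj, hQj⟩ => ⟨j, hj.trans hmn, hQj⟩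
  · simp only [hQ', h]
    exact ⟨fun ⟨n, hn⟩ => ⟨n, n, le_rfl, hn⟩, fun ⟨_, j, _, hj⟩ => ⟨j, hj⟩⟩

theorem of_rePred {P : α → Prop} (hP : REPred P) : OracleSemidec fun a (_ : ℕ → β) => P a := by
  obtain ⟨Q, hQ, h⟩ := exists_primrec_of_rePred hP
  exact ⟨fun p => Q (p.1, p.2.length), by fun_prop, fun a y => by simp only [h, length_history]⟩

theorem rePred (h : OracleSemidec P) {y : ℕ → β} (hy : Primrec y) : REPred fun a => P a y := by
  obtain ⟨Q, hQ, h⟩ := h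
  have hQy : Primrec fun p : α × ℕ => Q (p.1, history y p.2) := by
    unfold history
    fun_prop
  exact (rePred_exists_of_computable hQy.to_comp).of_eq fun a => (h a y).symm

theorem of_primrec {f : α → Bool} (hf : Primrec f) : OracleSemidec fun a (_ : ℕ → β) => f a :=
  ⟨fun p => f p.1, by fun_prop, fun _ _ => by simp⟩

theorem eq {f g : α → γ} (hf : Primrec f) (hg : Primrec g) :
    OracleSemidec fun a (_ : ℕ → β) => f a = g a := by
  classical
  exact (of_primrec (f := fun a => decide (f a = g a)) (by fun_prop)).of_iff fun _ _ => by simp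

theorem lt {f g : α → ℕ} (hf : Primrec f) (hg : Primrec g) :
    OracleSemidec fun a (_ : ℕ → β) => f a < g a :=
  (of_primrec (f := fun a => decide (f a < g a)) (by fun_prop)).of_iff fun _ _ => by simp

theorem query {f : α → ℕ} {R : α → β → Bool} (hf : Primrec f)
    (hR : Primrec fun p : α × β => R p.1 p.2) :
    OracleSemidec fun a (y : ℕ → β) => R a (y (f a)) := by
  refine ⟨fun p => (p.2[f p.1]?).elim false (R p.1), ?_, fun a y => ⟨fun h => ?_, ?_⟩⟩
  · have : Primrec fun p : (α × List β) × β => R p.1.1 p.2 :=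
      hR.comp (f := fun p : α × β => R p.1 p.2) (g := fun p : (α × List β) × β => (p.1.1, p.2))
        (by fun_prop)
    fun_prop
  · exact ⟨f a + 1, by simpa only [getElem?_history y (Nat.lt_succ_self _), Option.elim_some]⟩
  · rintro ⟨n, hn⟩
    rcases lt_or_ge (f a) n with hlt | hge
    · simpa only [getElem?_history y hlt, Option.elim_some] using hn
    · simp [length_history, hge] at hn

theorem comp {P : γ → (ℕ → β) → Prop} (h : OracleSemidec P) {f : α → γ} (hf : Primrec f) :
    OracleSemidec fun a y => P (f a) y := by
  obtain ⟨Q, hQ, h⟩ := h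
  exact ⟨fun p => Q (f p.1, p.2), by fun_prop, fun a => h (f a)⟩

theorem and (h : OracleSemidec P) (h' : OracleSemidec P') :
    OracleSemidec fun a y => P a y ∧ P' a y := by
  obtain ⟨Q, hQ, hmono, h⟩ := h.exists_monotone
  obtain ⟨Q', hQ', hmono', h'⟩ := h'.exists_monotone
  refine ⟨fun p => Q p && Q' p, by fun_prop, fun a y => ?_⟩
  simp only [Bool.and_eq_true, h, h']
  constructor
  · rintro ⟨⟨m, hm⟩, n, hn⟩
    exact ⟨max m n, hmono a y (le_max_left m n) hm, hmono' a y (le_max_right m n) hn⟩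
  · exact fun ⟨n, hn, hn'⟩ => ⟨⟨n, hn⟩, n, hn'⟩

theorem or (h : OracleSemidec P) (h' : OracleSemidec P') :
    OracleSemidec fun a y => P a y ∨ P' a y := by
  obtain ⟨Q, hQ, h⟩ := h
  obtain ⟨Q', hQ', h'⟩ := h'
  exact ⟨fun p => Q p || Q' p, by fun_prop, fun a y => by
    simp only [Bool.or_eq_true, h, h', exists_or]⟩

theorem ex {P : α → γ → (ℕ → β) → Prop}
    (h : OracleSemidec fun (p : α × γ) y => P p.1 p.2 y) :
    OracleSemidec fun a y => ∃ c, P a c y := by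
  obtain ⟨Q, hQ, hmono, h⟩ := h.exists_monotone
  have : Primrec fun p : ((α × List β) × ℕ) × γ => Q ((p.1.1.1, p.2), p.1.1.2) := by fun_prop
  refine ⟨fun p => (List.range p.2.length).any fun j =>
    (Encodable.decode j : Option γ).elim false fun c => Q ((p.1, c), p.2), by fun_prop, ?_⟩
  intro a y
  simp only [List.any_eq_true, List.mem_range, length_history]
  constructor
  · rintro ⟨c, hc⟩
    obtain ⟨n, hn⟩ := (h (a, c) y).1 hc
    refine ⟨max n (Encodable.encode c + 1), Encodable.encode c, by omega, ?_⟩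
    simp only [Encodable.encodek, Option.elim_some]
    exact hmono (a, c) y (le_max_left _ _) hn
  · rintro ⟨n, j, -, hj⟩
    cases hd : (Encodable.decode j : Option γ) with
    | none => simp [hd] at hj
    | some c => exact ⟨c, (h (a, c) y).2 ⟨n, by simpa only [hd, Option.elim_some] using hj⟩⟩

theorem all_mem {P : α → γ → (ℕ → β) → Prop} {f : α → List γ} (hf : Primrec f)
    (h : OracleSemidec fun (p : α × γ) y => P p.1 p.2 y) :
    OracleSemidec fun a y => ∀ c ∈ f a, P a c y := by
  obtain ⟨Q, hQ, hmono, h⟩ := h.exists_monotone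
  refine ⟨fun p => (f p.1).all fun c => Q ((p.1, c), p.2), by fun_prop, fun a y => ?_⟩
  simp only [List.all_eq_true]
  constructor
  · intro H
    choose! n hn using fun c hc => (h (a, c) y).1 (H c hc)
    have hle : ∀ c ∈ f a, n c ≤ ((f a).map n).sum := fun c hc =>
      List.single_le_sum (by simp) _ (List.mem_map_of_mem hc)
    exact ⟨_, fun c hc => hmono (a, c) y (hle c hc) (hn c hc)⟩
  · exact fun ⟨n, hn⟩ c hc => (h (a, c) y).2 ⟨n, hn c hc⟩

theorem all_lt {P : α → ℕ → (ℕ → β) → Prop} {f : α → ℕ} (hf : Primrec f)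
    (h : OracleSemidec fun (p : α × ℕ) y => P p.1 p.2 y) :
    OracleSemidec fun a y => ∀ i < f a, P a i y :=
  (all_mem (f := fun a => List.range (f a)) (by fun_prop) h).of_iff fun _ _ => by simp

theorem all_getElem? {P : α → ℕ → γ → (ℕ → β) → Prop} {f : α → List γ}
    (hf : Primrec f) (h : OracleSemidec fun (p : α × ℕ × γ) y => P p.1 p.2.1 p.2.2 y) :
    OracleSemidec fun a y => ∀ i c, (f a)[i]? = some c → P a i c y := by
  refine (all_lt (P := fun a i y => ∃ c, (f a)[i]? = some c ∧ P a i c y)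
    (f := fun a => (f a).length) (by fun_prop)
    (ex (and (eq (by fun_prop) (by fun_prop))
      (h.comp (f := fun q : (α × ℕ) × γ => (q.1.1, q.1.2, q.2)) (by fun_prop))))).of_iff
    fun a y => ⟨fun H i hi => ?_, fun H i c hc => ?_⟩
  · exact ⟨_, List.getElem?_eq_getElem hi, H i _ (List.getElem?_eq_getElem hi)⟩
  · obtain ⟨hi, -⟩ := List.getElem?_eq_some_iff.1 hc
    obtain ⟨d, hd, hP⟩ := H i hi
    rwa [Option.some_injective _ (hc.symm.trans hd)]

theorem reflTransGen {R : α → γ → γ → (ℕ → β) → Prop}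
    (h : OracleSemidec fun (p : α × γ × γ) y => R p.1 p.2.1 p.2.2 y) :
    OracleSemidec fun (p : α × γ × γ) y =>
      Relation.ReflTransGen (fun c d => R p.1 c d y) p.2.1 p.2.2 := by
  have hpath : OracleSemidec fun (p : α × γ × γ) (y : ℕ → β) => ∃ l : List γ,
      (p.2.1 :: l)[l.length]? = some p.2.2 ∧
        ∀ (i : ℕ) (d : γ), l[i]? = some d → ∃ c, (p.2.1 :: l)[i]? = some c ∧ R p.1 c d y := by
    refine ex (and (eq (by fun_prop) (by fun_prop)) (all_getElem? (by fun_prop)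
      (ex (and (eq (by fun_prop) (by fun_prop)) ?_))))
    exact h.comp (f := fun q : (((α × γ × γ) × List γ) × ℕ × γ) × γ =>
      (q.1.1.1.1, q.2, q.1.2.2)) (by fun_prop)
  exact hpath.of_iff fun p y => reflTransGen_iff_exists_path

end OracleSemidec

end OracleComputation

/-! ## Occurrences of wrapped words -/

section Words

variable {k : ℕ} {α β : Type*}

theorem exists_cons_of_iota_prefix {w x : Word k} (h : iota w <+: x) :
    ∃ z, x = 1 :: 1 :: 0 :: z := by
  obtain ⟨t, rfl⟩ := h
  cases w <;> exact ⟨_, rfl⟩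

theorem length_iota (w : Word k) : (iota w).length = 2 * w.length + 5 := by
  have hbody : (w.flatMap fun a => [0, a]).length = 2 * w.length := by
    induction w with
    | nil => rfl
    | cons a w ih => simp [ih, Nat.mul_succ]
  simp [iota, hbody]

theorem InWord.of_cons {w r : Word k} {a : Letter k} (h : InWord w (a :: r))
    (hr : ∀ z, a :: r ≠ 1 :: 1 :: 0 :: z) : InWord w r := by
  refine (List.infix_cons_iff.1 h).resolve_left fun hpre => ?_
  obtain ⟨z, hz⟩ := exists_cons_of_iota_prefix hpre
  exact hr z hz

theorem InWord.of_body_append {u w r : Word k}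
    (h : InWord w (u.flatMap (fun a => [0, a]) ++ 0 :: 1 :: 1 :: r))
    (h₀ : ∀ z, r ≠ 0 :: z) (h₁ : ∀ z, r ≠ 1 :: 0 :: z) : InWord w r := by
  induction u with
  | nil =>
    refine ((h.of_cons ?_).of_cons ?_).of_cons ?_
    · simp
    · simpa using h₀
    · simpa using h₁
  | cons a u ih =>
    refine ih ((InWord.of_cons h ?_).of_cons ?_)
    · simp
    · cases u <;> simp

/-- The concatenation of the blocks `ι(u)` for the entries `some u` and of padding symbols `1` for
the entries `none`. -/
def paddedTuple (l : List (Option (Word k))) : Word k := l.flatMap fun o => o.elim [1] iota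

theorem paddedTuple_ne_zero_cons (l : List (Option (Word k))) (z : Word k) :
    paddedTuple l ≠ 0 :: z := by
  rcases l with _ | ⟨_ | u, l⟩ <;> simp [paddedTuple, iota]

theorem paddedTuple_ne_one_cons_zero_cons (l : List (Option (Word k))) (z : Word k) :
    paddedTuple l ≠ 1 :: 0 :: z := by
  rcases l with _ | ⟨_ | u, l⟩
  · simp [paddedTuple]
  · exact fun h => paddedTuple_ne_zero_cons l z (List.cons.inj h).2
  · simp [paddedTuple, iota]

/-- The pattern `110` begins an occurrence of a word `ι(w)`, and it occurs in a concatenation of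
blocks only where a block `ι(u)` begins. -/
theorem inWord_paddedTuple {w : Word k} {l : List (Option (Word k))} :
    InWord w (paddedTuple l) ↔ some w ∈ l := by
  refine ⟨fun h => ?_, fun h => ?_⟩
  · induction l with
    | nil => simp [InWord, paddedTuple, iota] at h
    | cons o l ih =>
      rcases o with _ | u
      · have h' : InWord w (1 :: paddedTuple l) := h
        exact List.mem_cons_of_mem _ (ih (h'.of_cons fun z hz =>
          paddedTuple_ne_one_cons_zero_cons l z (List.cons.inj hz).2))
      · have h' : InWord w (1 :: 1 :: (u.flatMap (fun a => [0, a]) ++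
            0 :: 1 :: 1 :: paddedTuple l)) := by
          simpa [paddedTuple, iota] using h
        rcases List.infix_cons_iff.1 h' with ⟨t, ht⟩ | hinfix
        · have huw : iota w ++ t = iota u ++ paddedTuple l := by simpa [iota] using ht
          exact (iota_append_inj huw).1 ▸ List.mem_cons_self
        · refine List.mem_cons_of_mem _ (ih ((InWord.of_cons hinfix ?_).of_body_append
            (paddedTuple_ne_zero_cons l) (paddedTuple_ne_one_cons_zero_cons l)))
          cases u <;> simp
  · obtain ⟨l₁, l₂, rfl⟩ := List.append_of_mem h
    exact ⟨paddedTuple l₁, paddedTuple l₂, by simp [paddedTuple]⟩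

theorem inWord_tuple {a : Word k} {us : List (Word k)} : InWord a (tuple us) ↔ a ∈ us := by
  have htuple : tuple us = paddedTuple (us.map some) := by
    rw [tuple, paddedTuple, List.flatMap_map]
    rfl
  simp [htuple, inWord_paddedTuple]

theorem inSeq_iff_inWord_history {w : Word k} {p : OmegaWord k} :
    InSeq w p ↔ ∃ n, InWord w (history p n) := by
  simp only [InWord, List.infix_iff_getElem?, length_history]
  constructor
  · rintro ⟨n, hn⟩
    refine ⟨n + (iota w).length, n, by omega, fun i hi => ?_⟩
    rw [getElem?_history p (by omega), add_comm, hn i hi]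
  · rintro ⟨N, n, hN, hn⟩
    refine ⟨n, fun i hi => Option.some_injective _ ?_⟩
    rw [← hn i hi, getElem?_history p (by omega), add_comm]

/-- The sequence that lists the words `w` with `some w` in the range of `σ`. It is well defined by
prefixes of `σ` because no block is empty. -/
def listing (σ : ℕ → Option (Word k)) : OmegaWord k :=
  fun n => ((paddedTuple (history σ (n + 1)))[n]?).getD 1

theorem le_length_paddedTuple (l : List (Option (Word k))) :
    l.length ≤ (paddedTuple l).length := by
  induction l with
  | nil => exact Nat.zero_le _
  | cons o l ih =>
    have ho : 1 ≤ (o.elim [1] iota : Word k).length := by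
      cases o <;> simp [length_iota]
    simpa [paddedTuple, add_comm] using add_le_add ho ih

theorem paddedTuple_history_prefix (σ : ℕ → Option (Word k)) {m n : ℕ} (h : m ≤ n) :
    paddedTuple (history σ m) <+: paddedTuple (history σ n) := by
  have hsplit : history σ n = history σ m ++ (history σ n).drop m := by
    rw [← take_history σ h, List.take_append_drop]
  exact ⟨paddedTuple ((history σ n).drop m), by
    rw [paddedTuple, paddedTuple, ← List.flatMap_append, ← hsplit, paddedTuple]⟩

theorem getElem?_paddedTuple_history (σ : ℕ → Option (Word k)) {i n : ℕ}
    (h : i < (paddedTuple (history σ n)).length) :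
    (paddedTuple (history σ n))[i]? = some (listing σ i) := by
  have hi : i < (paddedTuple (history σ (i + 1))).length := by
    simpa [length_history] using le_length_paddedTuple (history σ (i + 1))
  have hlisting : (paddedTuple (history σ (i + 1)))[i]? = some (listing σ i) := by
    rw [listing, List.getElem?_eq_getElem hi, Option.getD_some]
  rw [← hlisting]
  rcases le_total n (i + 1) with hn | hn
  · obtain ⟨t, ht⟩ := paddedTuple_history_prefix σ hn
    rw [← ht, List.getElem?_append_left h]
  · obtain ⟨t, ht⟩ := paddedTuple_history_prefix σ hn
    rw [← ht, List.getElem?_append_left hi]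

theorem history_listing (σ : ℕ → Option (Word k)) (n : ℕ) :
    history (listing σ) (paddedTuple (history σ n)).length = paddedTuple (history σ n) := by
  refine List.ext_getElem? fun i => ?_
  rcases lt_or_ge i (paddedTuple (history σ n)).length with hi | hi
  · rw [getElem?_history _ hi, getElem?_paddedTuple_history σ hi]
  · rw [List.getElem?_eq_none hi, List.getElem?_eq_none (by rwa [length_history])]

theorem inSeq_listing {w : Word k} {σ : ℕ → Option (Word k)} :
    InSeq w (listing σ) ↔ ∃ n, σ n = some w := by
  have hmem (n : ℕ) : InWord w (paddedTuple (history σ n)) ↔ ∃ i < n, σ i = some w := by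
    simp [inWord_paddedTuple, history]
  rw [inSeq_iff_inWord_history]
  constructor
  · rintro ⟨n, hn⟩
    have hle : n ≤ (paddedTuple (history σ n)).length := by
      simpa [length_history] using le_length_paddedTuple (history σ n)
    have hpre : history (listing σ) n <+: paddedTuple (history σ n) := by
      rw [← history_listing, ← take_history _ hle]
      exact List.take_prefix _ _
    obtain ⟨i, -, hi⟩ := (hmem n).1 (List.IsInfix.trans hn hpre.isInfix)
    exact ⟨i, hi⟩
  · rintro ⟨i, hi⟩
    refine ⟨(paddedTuple (history σ (i + 1))).length, ?_⟩
    rw [history_listing σ (i + 1)]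
    exact (hmem (i + 1)).2 ⟨i, i.lt_succ_self, hi⟩

/-- The words `a` with `a ≪ w`. -/
def subwords (w : Word k) : List (Word k) :=
  ((List.range (w.length + 1)).flatMap fun s => (List.range (w.length + 1)).map fun l =>
      (List.range l).map fun j => (w[s + 3 + 2 * j]?).getD 0).filter
    fun a => (List.range (w.length + 1)).any fun n =>
      decide ((w.drop n).take (iota a).length = iota a)

theorem getElem?_iota {a : Word k} {j : ℕ} (hj : j < a.length) :
    (iota a)[3 + 2 * j]? = a[j]? := by
  have hbody (a : Word k) (j : ℕ) (hj : j < a.length) (r : Word k) :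
      (a.flatMap (fun b => [0, b]) ++ r)[2 * j + 1]? = a[j]? := by
    induction a generalizing j with
    | nil => simp at hj
    | cons b a ih =>
      cases j with
      | zero => rfl
      | succ j => simpa [Nat.mul_succ] using ih j (by simpa using hj)
  rw [iota, show 3 + 2 * j = (2 * j + 1) + 1 + 1 by ring]
  simpa using hbody a j hj [0, 1, 1]

theorem inWord_iff_take_drop {a w : Word k} :
    InWord a w ↔ ∃ n < w.length + 1, (w.drop n).take (iota a).length = iota a := by
  constructor
  · rintro ⟨s, t, rfl⟩
    exact ⟨s.length, by simp, by simp⟩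
  · rintro ⟨n, -, h⟩
    rw [InWord, ← h]
    exact (List.take_prefix _ _).isInfix.trans (List.drop_suffix _ _).isInfix

theorem mem_subwords {a w : Word k} : a ∈ subwords w ↔ InWord a w := by
  simp only [subwords, List.mem_filter, List.any_eq_true, List.mem_range, decide_eq_true_eq,
    ← inWord_iff_take_drop, and_iff_right_iff_imp, List.mem_flatMap, List.mem_map]
  rintro ⟨s, t, rfl⟩
  refine ⟨s.length, by simp, a.length, by simp [length_iota]; omega, ?_⟩
  refine List.ext_getElem? fun j => ?_
  rcases lt_or_ge j a.length with hj | hj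
  · have hlen : s.length + 3 + 2 * j < (s ++ iota a).length := by
      simp [length_iota]
      omega
    have hsymbol : (s ++ iota a ++ t)[s.length + 3 + 2 * j]? = a[j]? := by
      rw [List.getElem?_append_left hlen, List.getElem?_append_right (by omega),
        show s.length + 3 + 2 * j - s.length = 3 + 2 * j by omega, getElem?_iota hj]
    simp only [List.getElem?_map, List.getElem?_range hj, Option.map_some, hsymbol,
      List.getElem?_eq_getElem hj, Option.getD_some]
  · simp [hj]

/-- The finite set of the words `a` with `a ≪ w`. -/
def entries (w : Word k) : Set (Word k) := {a | InWord a w}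

theorem finite_entries (w : Word k) : (entries w).Finite :=
  (subwords w).finite_toSet.subset fun _ h => mem_subwords.2 h

theorem exists_entries_eq {s : Set (Word k)} (hs : s.Finite) : ∃ w, entries w = s :=
  ⟨tuple hs.toFinset.toList, Set.ext fun a => by simp [entries, inWord_tuple]⟩

/-- The set of the words `a` with `a ≪ p`. -/
def listed (p : OmegaWord k) : Set (Word k) := {a | InSeq a p}

variable [Primcodable α] [Primcodable β]

@[fun_prop]
theorem primrec_iota {f : α → Word k} (hf : Primrec f) : Primrec fun a => iota (f a) := by
  unfold iota
  fun_prop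

@[fun_prop]
theorem primrec_tuple {f : α → List (Word k)} (hf : Primrec f) :
    Primrec fun a => tuple (f a) := by
  unfold tuple
  fun_prop

@[fun_prop]
theorem primrec_paddedTuple {f : α → List (Option (Word k))} (hf : Primrec f) :
    Primrec fun a => paddedTuple (f a) := by
  unfold paddedTuple
  fun_prop

@[fun_prop]
theorem primrec_unary {f : α → ℕ} (hf : Primrec f) :
    Primrec fun a => (unary (f a) : Word k) := by
  have : Primrec fun a => (List.range (f a)).map fun _ => (0 : Letter k) := by fun_prop
  exact this.of_eq fun a => by simp [unary, List.map_const']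

@[fun_prop]
theorem primrec_subwords {f : α → Word k} (hf : Primrec f) :
    Primrec fun a => subwords (f a) := by
  unfold subwords
  fun_prop

theorem OracleSemidec.inSeq {p : α → (ℕ → β) → OmegaWord k} {f : α → Word k} (hf : Primrec f)
    (h : OracleSemidec fun (q : α × ℕ × Letter k) y => p q.1 y q.2.1 = q.2.2) :
    OracleSemidec fun a y => InSeq (f a) (p a y) := by
  have hsymbols : OracleSemidec fun a y => ∃ n : ℕ, ∀ (i : ℕ) (c : Letter k),
      (iota (f a))[i]? = some c → p a y (n + i) = c :=
    ex (all_getElem? (by fun_prop) (h.comp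
      (f := fun q : (α × ℕ) × ℕ × Letter k => (q.1.1, q.1.2 + q.2.1, q.2.2)) (by fun_prop)))
  refine hsymbols.of_iff fun a y => exists_congr fun n => ?_
  simp only [List.getElem?_eq_some_iff, forall_exists_index]
  exact ⟨fun H i c hi hc => hc ▸ H i hi, fun H i hi => H i _ hi rfl⟩

end Words

/-! ## Machines that enumerate semidecidable sets -/

section EnumeratingMachines

variable {k m : ℕ} {β : Type*}

/-- The word that the dovetailed search through all words and all prefixes of the oracle finds after
reading the list `l`, where `Q` is the acceptance test. -/
def acceptedAt (Q : Word k × List β → Bool) (l : List β) : Option (Word k) :=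
  (Encodable.decode l.length.unpair.1).elim none fun w =>
    bif Q (w, l.take l.length.unpair.2) then some w else none

theorem exists_acceptedAt_history {Q : Word k × List β → Bool} {y : ℕ → β} {w : Word k} :
    (∃ n, acceptedAt Q (history y n) = some w) ↔ ∃ n, Q (w, history y n) := by
  have haccepted (n : ℕ) : acceptedAt Q (history y n) = some w ↔
      Encodable.decode n.unpair.1 = some w ∧ Q (w, history y n.unpair.2) := by
    simp only [acceptedAt, length_history, take_history y (Nat.unpair_right_le n)]
    cases (Encodable.decode n.unpair.1 : Option (Word k)) with
    | none => simp
    | some v =>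
      cases hQv : Q (v, history y n.unpair.2) <;>
        simp only [Option.elim_some, hQv, cond_true, cond_false, Option.some_inj] <;> grind
  simp only [haccepted]
  constructor
  · exact fun ⟨_, _, hn⟩ => ⟨_, hn⟩
  · exact fun ⟨n, hn⟩ => ⟨Nat.pair (Encodable.encode w) n, by simpa using hn⟩

variable [Primcodable β]

@[fun_prop]
theorem primrec_acceptedAt {Q : Word k × List β → Bool} (hQ : Primrec Q) :
    Primrec (acceptedAt Q) := by
  unfold acceptedAt
  fun_prop

theorem OracleSemidec.exists_primrec_inSeq_iff {P : Word k → (ℕ → β) → Prop}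
    (hP : OracleSemidec P) : ∃ F : List β → Letter k, Primrec F ∧
      ∀ w y, InSeq w (fun n => F (history y n)) ↔ P w y := by
  obtain ⟨Q, hQ, h⟩ := hP
  refine ⟨fun l => ((paddedTuple ((List.range (l.length + 1)).map fun j =>
    acceptedAt Q (l.take j)))[l.length]?).getD 1, by fun_prop, fun w y => ?_⟩
  rw [h, ← exists_acceptedAt_history, ← inSeq_listing]
  refine iff_of_eq (congrArg (InSeq w) (funext fun n => ?_))
  have hstages : (List.range (n + 1)).map (fun j => acceptedAt Q ((history y n).take j)) =
      history (fun j => acceptedAt Q (history y j)) (n + 1) :=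
    List.map_congr_left fun j hj => by
      rw [take_history y (Nat.lt_succ_iff.1 (List.mem_range.1 hj))]
  simp only [listing, length_history, hstages]

namespace Type2Machine

/-- The machine that in the step `t` reads the cell `t` of all its input tapes and writes `F h`,
where `h` is the list of the symbols read in the earlier steps. -/
def ofHistory (F : List (Fin m → Option (Letter k)) → Letter k) (hF : Primrec F) :
    Type2Machine k m where
  Mem := List (Fin m → Option (Letter k))
  start := []
  step h s := (h ++ [s], fun _ => true, some (F h))
  step_computable := by
    have hstep : Primrec fun p : List (Fin m → Option (Letter k)) × (Fin m → Option (Letter k)) =>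
        (p.1 ++ [p.2], (fun _ => true : Fin m → Bool), some (F p.1)) :=
      Primrec.pair (by fun_prop) (Primrec.pair (Primrec.const _) (by fun_prop))
    exact hstep.to_comp

variable {F : List (Fin m → Option (Letter k)) → Letter k}

theorem config_ofHistory (hF : Primrec F) (y : Fin m → InTape k) (t : ℕ) :
    (ofHistory F hF).config y t = ⟨history (fun t i => y i t) t, fun _ => t,
      history (fun n => F (history (fun t i => y i t) n)) t⟩ := by
  induction t with
  | zero => rfl
  | succ t ih =>
    rw [config, ih, history_succ, history_succ]
    rfl

theorem computes_ofHistory_iff (hF : Primrec F) {y : Fin m → InTape k} {q : OmegaWord k} :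
    (ofHistory F hF).Computes y q ↔ q = fun n => F (history (fun t i => y i t) n) := by
  simp only [Computes, config_ofHistory]
  constructor
  · intro h
    funext n
    obtain ⟨t, ht⟩ := h n
    obtain ⟨hlt, -⟩ := List.getElem?_eq_some_iff.1 ht
    rw [getElem?_history _ (by rwa [length_history] at hlt)] at ht
    exact (Option.some_injective _ ht).symm
  · rintro rfl n
    exact ⟨n + 1, getElem?_history _ n.lt_succ_self⟩

end Type2Machine

theorem OracleSemidec.exists_seqComputable
    {P : Word k → (ℕ → Fin 1 → Option (Letter k)) → Prop} (hP : OracleSemidec P) :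
    ∃ g : OmegaWord k →. OmegaWord k, SeqComputable g ∧
      ∀ p, ∃ q ∈ g p, ∀ w, InSeq w q ↔ P w fun t _ => some (p t) := by
  obtain ⟨F, hF, h⟩ := hP.exists_primrec_inSeq_iff
  refine ⟨fun p => Part.some fun n => F (history (fun t _ => some (p t)) n),
    ⟨.ofHistory F hF, fun p q => ?_⟩, fun p => ⟨_, Part.mem_some _, fun w => h w _⟩⟩
  have htape : (fun t i => (![seqTape p] : Fin 1 → InTape k) i t) = fun t _ => some (p t) := by
    funext t i
    rw [Subsingleton.elim i 0]
    rfl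
  rw [Type2Machine.computes_ofHistory_iff, Part.mem_some_iff, htape]

theorem OracleSemidec.exists_wordSeqComputable
    {P : Word k → (ℕ → Fin 2 → Option (Letter k)) → Prop} (hP : OracleSemidec P) :
    ∃ f : Word k → OmegaWord k →. OmegaWord k, WordSeqComputable f ∧
      ∀ u p, ∃ q ∈ f u p, ∀ w, InSeq w q ↔ P w fun t => ![u[t]?, some (p t)] := by
  obtain ⟨F, hF, h⟩ := hP.exists_primrec_inSeq_iff
  refine ⟨fun u p => Part.some fun n => F (history (fun t => ![u[t]?, some (p t)]) n),
    ⟨.ofHistory F hF, fun u p q => ?_⟩, fun u p => ⟨_, Part.mem_some _, fun w => h w _⟩⟩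
  have htape : (fun t i => (![wordTape u, seqTape p] : Fin 2 → InTape k) i t) =
      fun t => ![u[t]?, some (p t)] := by
    funext t i
    fin_cases i <;> rfl
  rw [Type2Machine.computes_ofHistory_iff, Part.mem_some_iff, htape]

end EnumeratingMachines

/-! ## Covers of boxes -/

section Covers

variable {k : ℕ}

/-- The words whose entries lie in `D` and meet every member of `𝒦`. If `𝒦` consists of the sets
`{a | x ∈ ν(a)}` for the points `x` of a set `K`, these words are the finite covers of `K`. -/
def covers (D : Set (Word k)) (𝒦 : Set (Set (Word k))) : Set (Word k) :=
  {w | entries w ⊆ D ∧ ∀ T ∈ 𝒦, (entries w ∩ T).Nonempty}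

/-- The property of the neighbourhood traces `𝒦` of the points of a compact set that makes covers
of products effective: for a formal inclusion `Sub c a` of basic sets, there are finite covers whose
entries are formally included in any finitely many given neighbourhoods of a point. -/
structure HasFineCovers (D : Set (Word k)) (𝒦 : Set (Set (Word k)))
    (Sub : Word k → Word k → Prop) : Prop where
  mem_of_sub : ∀ T ∈ 𝒦, ∀ c ∈ T, ∀ a, Sub c a → a ∈ T
  exists_fine_cover : ∀ F : Set (Word k), F.Finite →
    ∃ u ∈ covers D 𝒦, ∀ c ∈ entries u, ∃ T ∈ 𝒦, ∀ a ∈ F ∩ T, Sub c a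

theorem HasFineCovers.biUnion_entries {D : Set (Word k)} {𝒦 : Set (Set (Word k))}
    {Sub : Word k → Word k → Prop} (h : HasFineCovers D 𝒦 Sub) :
    ⋃ u ∈ covers D 𝒦, entries u = D := by
  refine Set.Subset.antisymm (Set.iUnion₂_subset fun u hu => hu.1) fun a ha => ?_
  obtain ⟨u, hu, -⟩ := h.exists_fine_cover ∅ Set.finite_empty
  obtain ⟨w, hw⟩ := exists_entries_eq ((finite_entries u).insert a)
  refine Set.mem_biUnion (x := w) ⟨?_, fun T hT => ?_⟩ (hw ▸ Set.mem_insert a _)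
  · rw [hw]
    exact Set.insert_subset ha hu.1
  · exact (hu.2 T hT).mono (Set.inter_subset_inter_left T (hw ▸ Set.subset_insert a _))

/-- The finite lists, of any length, whose entry at each position `i` lies in `A i`. -/
def listProd (A : ℕ → Set (Word k)) : Set (List (Word k)) :=
  {us | ∀ i a, us[i]? = some a → a ∈ A i}

theorem exists_forall₂_mem_listProd {R : Word k → Word k → Prop} {W : List (Word k)}
    {A : ℕ → Set (Word k)} (h : ∀ i u, W[i]? = some u → ∃ c ∈ A i, R c u) :
    ∃ cs ∈ listProd A, List.Forall₂ R cs W := by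
  induction W generalizing A with
  | nil => exact ⟨[], by simp [listProd], .nil⟩
  | cons u W ih =>
    obtain ⟨c, hc, hcu⟩ := h 0 u rfl
    obtain ⟨cs, hcs, hR⟩ := ih (A := fun i => A (i + 1)) fun i u' hu' => h (i + 1) u' hu'
    refine ⟨c :: cs, fun i a ha => ?_, .cons hcu hR⟩
    cases i with
    | zero => exact Option.some_injective _ ha ▸ hc
    | succ i => exact hcs i a ha

/-- The positions that occur in the lists of `V`. -/
def positions (V : Set (List (Word k))) : Set ℕ := {i | ∃ us ∈ V, i < us.length}

theorem exists_length_bound {L V : Set (List (Word k))} (hL : L.Finite) (hLV : L ⊆ V) :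
    ∃ N, Set.Iio N ⊆ positions V ∧ ∀ us ∈ L, us.length ≤ N := by
  refine ⟨hL.toFinset.sup List.length, fun i hi => ?_, fun us hus =>
    Finset.le_sup (f := List.length) (hL.mem_toFinset.2 hus)⟩
  obtain ⟨us, hus, hlt⟩ := Finset.lt_sup_iff.1 (Set.mem_Iio.1 hi)
  exact ⟨us, hLV (hL.mem_toFinset.1 hus), hlt⟩

theorem exists_length_bound_forall {L V : Set (List (Word k))} (hL : L.Finite) (hLV : L ⊆ V)
    (P : ℕ → Prop) : ∃ N, Set.Iio N ⊆ positions V ∧ (∀ us ∈ L, us.length ≤ N) ∧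
      ((∀ i < N, P i) → ∀ i ∈ positions V, P i) := by
  by_cases hP : ∀ i ∈ positions V, P i
  · obtain ⟨N, hN, hlen⟩ := exists_length_bound hL hLV
    exact ⟨N, hN, hlen, fun _ => hP⟩
  · push Not at hP
    obtain ⟨j, ⟨vs, hvs, hj⟩, hPj⟩ := hP
    obtain ⟨N, hN, hlen⟩ := exists_length_bound (hL.insert vs) (Set.insert_subset hvs hLV)
    refine ⟨N, hN, fun us hus => hlen us (Set.mem_insert_of_mem vs hus), fun H => ?_⟩
    exact absurd (H j (hj.trans_le (hlen vs (Set.mem_insert vs L)))) hPj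

/-- The codes of the lists in `V` with entries in the sets `A i`, where `c` codes lists by words. -/
def box (c : List (Word k) → Word k) (V : Set (List (Word k))) (A : ℕ → Set (Word k)) :
    Set (Word k) :=
  c '' (V ∩ listProd A)

/-- The boxes with sides in `𝒦 i`. -/
def boxes (c : List (Word k) → Word k) (V : Set (List (Word k)))
    (𝒦 : ℕ → Set (Set (Word k))) : Set (Set (Word k)) :=
  {B | ∃ T : ℕ → Set (Word k), (∀ i ∈ positions V, T i ∈ 𝒦 i) ∧ B = box c V T}

/-- The condition that recognizes the finite covers of a product from sets `E i` of finite covers of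
the factors: there are finite covers of finitely many factors such that every product of entries of
these covers is formally included in an entry of `w`. -/
def productCovers (c : List (Word k) → Word k) (V : Set (List (Word k))) (E : ℕ → Set (Word k))
    (Sub : ℕ → Word k → Word k → Prop) : Set (Word k) :=
  {w | entries w ⊆ box c V (fun i => ⋃ u ∈ E i, entries u) ∧
    ∃ W ∈ listProd E, Set.Iio W.length ⊆ positions V ∧
      ∀ cs, List.Forall₂ InWord cs W → ∃ us ∈ V, c us ∈ entries w ∧
        us ∈ listProd fun i => {a | ∃ d, cs[i]? = some d ∧ Sub i d a}}

section Boxes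

variable {c : List (Word k) → Word k} {V : Set (List (Word k))}

theorem box_congr {A B : ℕ → Set (Word k)} (h : ∀ i ∈ positions V, A i = B i) :
    box c V A = box c V B := by
  refine congrArg (c '' ·) (Set.ext fun us => and_congr_right fun hus => ?_)
  refine forall_congr' fun i => forall₂_congr fun a ha => ?_
  rw [h i ⟨us, hus, (List.getElem?_eq_some_iff.1 ha).1⟩]

theorem sUnion_boxes {𝒦 : ℕ → Set (Set (Word k))}
    (h : ∀ us ∈ V, ∀ i ∈ positions V, us.length ≤ i → (𝒦 i).Nonempty) :
    ⋃₀ boxes c V 𝒦 = box c V fun i => ⋃₀ 𝒦 i := by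
  ext v
  constructor
  · rintro ⟨_, ⟨T, hT, rfl⟩, us, ⟨hV, hus⟩, rfl⟩
    exact ⟨us, ⟨hV, fun i a ha =>
      ⟨T i, hT i ⟨us, hV, (List.getElem?_eq_some_iff.1 ha).1⟩, hus i a ha⟩⟩, rfl⟩
  · rintro ⟨us, ⟨hV, hus⟩, rfl⟩
    have hside : ∀ i ∈ positions V, ∃ T ∈ 𝒦 i, ∀ a, us[i]? = some a → a ∈ T := by
      intro i hi
      cases ha : us[i]? with
      | none =>
        obtain ⟨T, hT⟩ := h us hV i hi (List.getElem?_eq_none_iff.1 ha)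
        exact ⟨T, hT, by simp⟩
      | some a =>
        obtain ⟨T, hT, haT⟩ := hus i a ha
        exact ⟨T, hT, fun b hb => Option.some_injective _ hb ▸ haT⟩
    choose! T hT husT using hside
    exact ⟨_, ⟨T, hT, rfl⟩, us, ⟨hV, fun i a ha =>
      husT i ⟨us, hV, (List.getElem?_eq_some_iff.1 ha).1⟩ a ha⟩, rfl⟩

variable {D : ℕ → Set (Word k)} {𝒦 : ℕ → Set (Set (Word k))} {Sub : ℕ → Word k → Word k → Prop}

theorem exists_fine_product_cover
    (h : ∀ i ∈ positions V, HasFineCovers (D i) (𝒦 i) (Sub i))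
    {L : Set (List (Word k))} (hL : L.Finite) (hLV : L ⊆ V)
    (hcover : ∀ T : ℕ → Set (Word k), (∀ i ∈ positions V, T i ∈ 𝒦 i) → (L ∩ listProd T).Nonempty) :
    ∃ W ∈ listProd fun i => covers (D i) (𝒦 i), Set.Iio W.length ⊆ positions V ∧
      ∀ cs, List.Forall₂ InWord cs W →
        (L ∩ listProd fun i => {a | ∃ d, cs[i]? = some d ∧ Sub i d a}).Nonempty := by
  have hF (i : ℕ) : (some ⁻¹' ((fun us : List (Word k) => us[i]?) '' L)).Finite :=
    (hL.image _).preimage (Option.some_injective _).injOn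
  choose! u hu hfine using fun i hi => (h i hi).exists_fine_cover _ (hF i)
  obtain ⟨N, hN, hlen, hne⟩ := exists_length_bound_forall hL hLV fun i => (𝒦 i).Nonempty
  refine ⟨history u N, fun i v hv => ?_, by rwa [length_history], fun cs hcs => ?_⟩
  · have hi : i < N := by simpa only [length_history] using (List.getElem?_eq_some_iff.1 hv).1
    rw [getElem?_history u hi, Option.some_inj] at hv
    exact hv ▸ hu i (hN hi)
  · obtain ⟨hlength, hentry⟩ := List.forall₂_iff_get.1 hcs
    rw [length_history] at hlength
    have hside : ∀ i < N, ∃ T ∈ 𝒦 i, ∃ d, cs[i]? = some d ∧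
        ∀ us ∈ L, ∀ a ∈ T, us[i]? = some a → Sub i d a := by
      intro i hi
      have hd : InWord cs[i] (u i) := by
        simpa [history] using hentry i (by omega) (by simpa [history])
      obtain ⟨T, hT, hsub⟩ := hfine i (hN hi) cs[i] hd
      exact ⟨T, hT, cs[i], List.getElem?_eq_getElem _, fun us hus a haT ha =>
        hsub a ⟨⟨us, hus, ha⟩, haT⟩⟩
    have hside' : ∀ i ∈ positions V, ∃ T ∈ 𝒦 i, i < N → ∃ d, cs[i]? = some d ∧
        ∀ us ∈ L, ∀ a ∈ T, us[i]? = some a → Sub i d a := by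
      intro i hi
      by_cases hiN : i < N
      · obtain ⟨T, hT, hd⟩ := hside i hiN
        exact ⟨T, hT, fun _ => hd⟩
      · obtain ⟨T, hT⟩ := hne (fun i hi => (hside i hi).imp fun _ => And.left) i hi
        exact ⟨T, hT, fun hi => absurd hi hiN⟩
    choose! T hT hsub using hside'
    obtain ⟨us, hus, husT⟩ := hcover T hT
    refine ⟨us, hus, fun i a ha => ?_⟩
    have hi := (List.getElem?_eq_some_iff.1 ha).1
    obtain ⟨d, hd, hda⟩ := hsub i ⟨us, hLV hus, hi⟩ (hi.trans_le (hlen us hus))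
    exact ⟨d, hd, hda us hus a (husT i a ha) ha⟩

theorem productCovers_eq_covers (hc : Set.InjOn c V)
    (h : ∀ i ∈ positions V, HasFineCovers (D i) (𝒦 i) (Sub i)) {E : ℕ → Set (Word k)}
    (hE : ∀ i ∈ positions V, E i = covers (D i) (𝒦 i)) :
    productCovers c V E Sub = covers (box c V D) (boxes c V 𝒦) := by
  have hbox : box c V (fun i => ⋃ u ∈ E i, entries u) = box c V D :=
    box_congr fun i hi => by rw [hE i hi, (h i hi).biUnion_entries]
  ext w
  rw [productCovers, hbox]
  refine and_congr_right fun _ => ⟨?_, fun hw => ?_⟩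
  · rintro ⟨W, hW, hlen, hcs⟩ _ ⟨T, hT, rfl⟩
    obtain ⟨cs, hcsT, hcsW⟩ : ∃ cs ∈ listProd T, List.Forall₂ InWord cs W := by
      refine exists_forall₂_mem_listProd fun i u hu => ?_
      have hi : i ∈ positions V := hlen (List.getElem?_eq_some_iff.1 hu).1
      obtain ⟨d, hd, hdT⟩ := (hE i hi ▸ hW i u hu : u ∈ covers (D i) (𝒦 i)).2 (T i) (hT i hi)
      exact ⟨d, hdT, hd⟩
    obtain ⟨us, hV, hus, hsub⟩ := hcs cs hcsW
    refine ⟨c us, hus, us, ⟨hV, fun i a ha => ?_⟩, rfl⟩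
    have hi : i ∈ positions V := ⟨us, hV, (List.getElem?_eq_some_iff.1 ha).1⟩
    obtain ⟨d, hd, hda⟩ := hsub i a ha
    exact (h i hi).mem_of_sub (T i) (hT i hi) d (hcsT i d hd) a hda
  · set L := {us ∈ V | c us ∈ entries w}
    have hLfin : L.Finite :=
      ((finite_entries w).subset (Set.image_subset_iff.2 fun us hus => hus.2)).of_finite_image
        (hc.mono (Set.sep_subset _ _))
    obtain ⟨W, hW, hlen, hcs⟩ := exists_fine_product_cover h hLfin (Set.sep_subset _ _)
      fun T hT => by
        obtain ⟨_, hv, us, ⟨hV, husT⟩, rfl⟩ := hw _ ⟨T, hT, rfl⟩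
        exact ⟨us, ⟨hV, hv⟩, husT⟩
    refine ⟨W, fun i u hu => ?_, hlen, fun cs hcsW => ?_⟩
    · rw [hE i (hlen (List.getElem?_eq_some_iff.1 hu).1)]
      exact hW i u hu
    · obtain ⟨us, ⟨hV, hus⟩, hsub⟩ := hcs cs hcsW
      exact ⟨us, hV, hus, hsub⟩

end Boxes

variable {α β : Type*} [Primcodable α] [Primcodable β]

@[fun_prop]
theorem primrec_sections {f : α → List (List β)} (hf : Primrec f) :
    Primrec fun a => (f a).sections := by
  have : Primrec fun a => (f a).foldr
      (fun l r => r.flatMap fun s : List β => l.map fun b => b :: s) [[]] := by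
    fun_prop
  refine this.of_eq fun a => ?_
  induction f a with
  | nil => rfl
  | cons l L ih => rw [List.foldr_cons, ih, List.sections]

theorem mem_sections_map_subwords {W cs : List (Word k)} :
    cs ∈ (W.map subwords).sections ↔ List.Forall₂ InWord cs W := by
  simp only [List.mem_sections, List.forall₂_map_right_iff, mem_subwords]

theorem OracleSemidec.mem_entries {f g : α → Word k} (hf : Primrec f) (hg : Primrec g) :
    OracleSemidec fun a (_ : ℕ → β) => f a ∈ entries (g a) :=
  (of_primrec (f := fun a => (subwords (g a)).any fun b => decide (f a = b))
    (by fun_prop)).of_iff fun _ _ => by simp [entries, mem_subwords]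

theorem OracleSemidec.mem_listProd {A : α → (ℕ → β) → ℕ → Set (Word k)}
    (hA : OracleSemidec fun (p : α × ℕ × Word k) y => p.2.2 ∈ A p.1 y p.2.1)
    {f : α → List (Word k)} (hf : Primrec f) :
    OracleSemidec fun a y => f a ∈ listProd (A a y) :=
  (all_getElem? hf hA).of_iff fun _ _ => Iff.rfl

variable {c : List (Word k) → Word k} {V : (ℕ → β) → Set (List (Word k))}
  {E : (ℕ → β) → ℕ → Set (Word k)} {Sub : (ℕ → β) → ℕ → Word k → Word k → Prop}

theorem OracleSemidec.entries_subset_box (hc : Primrec c)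
    (hV : OracleSemidec fun us y => us ∈ V y)
    (hE : OracleSemidec fun (p : ℕ × Word k) y => p.2 ∈ E y p.1) :
    OracleSemidec fun w y => entries w ⊆ box c (V y) fun i => ⋃ u ∈ E y i, entries u := by
  have hentry : OracleSemidec fun (p : List (Word k) × ℕ × Word k) y =>
      ∃ u, u ∈ E y p.2.1 ∧ p.2.2 ∈ entries u :=
    ex (and (hE.comp (f := fun q : (List (Word k) × ℕ × Word k) × Word k => (q.1.2.1, q.2))
      (by fun_prop)) (mem_entries (by fun_prop) (by fun_prop)))
  have hprod : OracleSemidec fun (us : List (Word k)) y =>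
      us ∈ listProd fun i => ⋃ u ∈ E y i, entries u :=
    mem_listProd (f := id) (hentry.of_iff fun _ _ => by simp) (by fun_prop)
  have hbox : OracleSemidec fun (v : Word k) y =>
      ∃ us, (us ∈ V y ∧ us ∈ listProd fun i => ⋃ u ∈ E y i, entries u) ∧ c us = v :=
    ex (and (comp (hV.and hprod) (f := fun q : Word k × List (Word k) => q.2) (by fun_prop))
      (eq (by fun_prop) (by fun_prop)))
  have hboxes : OracleSemidec fun (w : Word k) y => ∀ v ∈ subwords w,
      ∃ us, (us ∈ V y ∧ us ∈ listProd fun i => ⋃ u ∈ E y i, entries u) ∧ c us = v :=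
    all_mem (by fun_prop) (hbox.comp (f := fun q : Word k × Word k => q.2) (by fun_prop))
  exact hboxes.of_iff fun w y => forall_congr' fun v => imp_congr_left mem_subwords.symm

theorem OracleSemidec.productCovers (hc : Primrec c)
    (hV : OracleSemidec fun us y => us ∈ V y)
    (hE : OracleSemidec fun (p : ℕ × Word k) y => p.2 ∈ E y p.1)
    (hSub : OracleSemidec fun (p : ℕ × Word k × Word k) y => Sub y p.1 p.2.1 p.2.2) :
    OracleSemidec fun w y => w ∈ productCovers c (V y) (E y) (Sub y) := by
  have hpositions : OracleSemidec fun (W : List (Word k)) y =>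
      ∀ i < W.length, ∃ us, us ∈ V y ∧ i < us.length :=
    all_lt (by fun_prop) (ex (and
      (hV.comp (f := fun q : (List (Word k) × ℕ) × List (Word k) => q.2) (by fun_prop))
      (lt (by fun_prop) (by fun_prop))))
  have hfactors : OracleSemidec fun (W : List (Word k)) y => W ∈ listProd (E y) :=
    mem_listProd (f := id) (hE.comp (f := fun q : List (Word k) × ℕ × Word k => q.2)
      (by fun_prop)) (by fun_prop)
  have hsub : OracleSemidec fun (p : List (Word k) × List (Word k)) y =>
      p.2 ∈ listProd fun i => {a | ∃ d, p.1[i]? = some d ∧ Sub y i d a} :=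
    mem_listProd (ex (and (eq (by fun_prop) (by fun_prop)) (hSub.comp
      (f := fun q : ((List (Word k) × List (Word k)) × ℕ × Word k) × Word k =>
        (q.1.2.1, q.2, q.1.2.2)) (by fun_prop)))) (by fun_prop)
  have hrefines : OracleSemidec fun (p : Word k × List (Word k)) y => ∃ us, us ∈ V y ∧
      c us ∈ entries p.1 ∧ us ∈ listProd fun i => {a | ∃ d, p.2[i]? = some d ∧ Sub y i d a} :=
    ex (and (hV.comp (f := fun q : (Word k × List (Word k)) × List (Word k) => q.2) (by fun_prop))
      (and (mem_entries (by fun_prop) (by fun_prop)) (hsub.comp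
        (f := fun q : (Word k × List (Word k)) × List (Word k) => (q.1.2, q.2)) (by fun_prop))))
  have hcovers : OracleSemidec fun (p : Word k × List (Word k)) y =>
      ∀ cs ∈ (p.2.map subwords).sections, ∃ us, us ∈ V y ∧ c us ∈ entries p.1 ∧
        us ∈ listProd fun i => {a | ∃ d, cs[i]? = some d ∧ Sub y i d a} :=
    all_mem (by fun_prop) (hrefines.comp
      (f := fun q : (Word k × List (Word k)) × List (Word k) => (q.1.1, q.2)) (by fun_prop))
  have hexists : OracleSemidec fun (w : Word k) y => ∃ W : List (Word k), W ∈ listProd (E y) ∧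
      (∀ i < W.length, ∃ us, us ∈ V y ∧ i < us.length) ∧
        ∀ cs ∈ (W.map subwords).sections, ∃ us, us ∈ V y ∧ c us ∈ entries w ∧
          us ∈ listProd fun i => {a | ∃ d, cs[i]? = some d ∧ Sub y i d a} :=
    ex ((hfactors.comp (f := fun q : Word k × List (Word k) => q.2) (by fun_prop)).and
      ((hpositions.comp (f := fun q : Word k × List (Word k) => q.2) (by fun_prop)).and hcovers))
  refine ((entries_subset_box hc hV hE).and hexists).of_iff fun w y => ?_
  simp only [mem_sections_map_subwords]
  exact Iff.rfl

end Covers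

/-! ## Covers by base elements -/

section Traces

variable {k : ℕ}

/-- Formal inclusion `c ⊆ a` of basic sets, generated by the inclusions `ν(c) ⊆ ν(a)` and
`ν(c) ⊆ ν(b)` that a triple `(a, b, c) ∈ S` witnesses if `S` realizes intersection. -/
def FormalSub (S : Set (Word k × Word k × Word k)) : Word k → Word k → Prop :=
  Relation.ReflTransGen fun c a => ∃ b, (a, b, c) ∈ S ∨ (b, a, c) ∈ S

namespace EffSpace

/-- The traces `{a | x ∈ ν(a)}` of the points `x` of `K` on the base notation. -/
def traces (X : EffSpace.{u} k) (K : Set X) : Set (Set (Word k)) :=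
  (fun x => {a | x ∈ X.nu a}) '' K

theorem sUnion_traces (X : EffSpace.{u} k) (K : Set X) :
    ⋃₀ X.traces K = {a | (X.nu a ∩ K).Nonempty} := by
  ext a
  simp only [traces, Set.sUnion_image, Set.mem_iUnion, Set.mem_ofPred_eq]
  exact ⟨fun ⟨x, hx, ha⟩ => ⟨x, ha, hx⟩, fun ⟨x, ha, hx⟩ => ⟨x, hx, ha⟩⟩

theorem sUnion_traces_subset (X : EffSpace.{u} k) (K : Set X) : ⋃₀ X.traces K ⊆ X.dom := by
  rw [sUnion_traces]
  rintro a ⟨x, hx, -⟩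
  exact X.mem_dom hx

theorem kappa_iff (X : EffSpace.{u} k) {p : OmegaWord k} {K : Compacts X} :
    X.kappa p K ↔ listed p = covers X.dom (X.traces K) := by
  rw [Set.ext_iff]
  refine forall_congr' fun w => iff_congr Iff.rfl (and_congr Iff.rfl ?_)
  rw [traces, Set.forall_mem_image]
  rfl

theorem kappaMin_iff (X : EffSpace.{u} k) {p : OmegaWord k} {K : Compacts X} :
    X.kappaMin p K ↔ listed p = covers (⋃₀ X.traces K) (X.traces K) := by
  rw [Set.ext_iff]
  refine forall_congr' fun w => iff_congr Iff.rfl ?_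
  have hmeets : (∀ T ∈ X.traces K, (entries w ∩ T).Nonempty) ↔ (K : Set X) ⊆ X.fsUnion w :=
    Set.forall_mem_image
  rw [covers, Set.mem_ofPred_eq, hmeets]
  refine ⟨fun ⟨_, hK, hw⟩ => ⟨(X.sUnion_traces K).symm ▸ hw, hK⟩, fun ⟨hw, hK⟩ =>
    ⟨hw.trans (X.sUnion_traces_subset K), hK, ?_⟩⟩
  rwa [sUnion_traces] at hw

section FineCovers

variable (X : EffSpace.{u} k) {S : Set (Word k × Word k × Word k)}

theorem mem_nu_of_formalSub (hS : X.Intersects S) {x : X} {a c : Word k} (hc : x ∈ X.nu c)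
    (h : FormalSub S c a) : x ∈ X.nu a := by
  induction h with
  | refl => exact hc
  | @tail c a _ hstep hxc =>
    have hinter {a b : Word k} (hab : (a, b, c) ∈ S) : x ∈ X.nu a ∩ X.nu b := by
      obtain ⟨ha, hb, -⟩ := hS.1 a b c hab
      rw [hS.2 a ha b hb]
      exact ⟨c, hab, hxc⟩
    obtain ⟨b, hab | hba⟩ := hstep
    · exact (hinter hab).1
    · exact (hinter hba).2

theorem exists_formalSub_of_finite (hS : X.Intersects S) (x : X) {F : Set (Word k)}
    (hF : F.Finite) : ∃ c, x ∈ X.nu c ∧ ∀ a ∈ F, x ∈ X.nu a → FormalSub S c a := by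
  induction F, hF using Set.Finite.induction_on with
  | empty =>
    obtain ⟨_, ⟨c, -, rfl⟩, hxc, -⟩ :=
      X.isBasis.exists_subset_of_mem_open (Set.mem_univ x) isOpen_univ
    exact ⟨c, hxc, by simp⟩
  | @insert a F _ _ ih =>
    obtain ⟨c, hxc, hsub⟩ := ih
    by_cases ha : x ∈ X.nu a
    · obtain ⟨d, hd, hxd⟩ : ∃ d, (a, c, d) ∈ S ∧ x ∈ X.nu d := by
        have hx : x ∈ X.nu a ∩ X.nu c := ⟨ha, hxc⟩
        rwa [hS.2 a (X.mem_dom ha) c (X.mem_dom hxc)] at hx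
      refine ⟨d, hxd, Set.forall_mem_insert.2 ⟨fun _ => .single ⟨c, Or.inl hd⟩, fun b hb hxb => ?_⟩⟩
      exact .head ⟨a, Or.inr hd⟩ (hsub b hb hxb)
    · exact ⟨c, hxc, Set.forall_mem_insert.2 ⟨fun hxa => absurd hxa ha, hsub⟩⟩

theorem hasFineCovers (hS : X.Intersects S) {K : Set X} (hK : IsCompact K) {D : Set (Word k)}
    (hD : ⋃₀ X.traces K ⊆ D) : HasFineCovers D (X.traces K) (FormalSub S) where
  mem_of_sub := by
    rintro _ ⟨x, -, rfl⟩ c hc a hca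
    exact X.mem_nu_of_formalSub hS hc hca
  exists_fine_cover F hF := by
    choose c hxc hsub using fun x => X.exists_formalSub_of_finite hS x hF
    obtain ⟨t, htK, hcover⟩ := hK.elim_nhds_subcover (fun x => X.nu (c x)) fun x _ =>
      (X.isBasis.isOpen ⟨c x, X.mem_dom (hxc x), rfl⟩).mem_nhds (hxc x)
    obtain ⟨u, hu⟩ := exists_entries_eq (t.finite_toSet.image c)
    refine ⟨u, ⟨?_, ?_⟩, ?_⟩
    · rw [hu]
      rintro _ ⟨x, hx, rfl⟩
      exact hD ⟨_, ⟨x, htK x hx, rfl⟩, hxc x⟩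
    · rw [hu]
      rintro _ ⟨x, hx, rfl⟩
      obtain ⟨z, hz, hxz⟩ := Set.mem_iUnion₂.1 (hcover hx)
      exact ⟨c z, ⟨z, hz, rfl⟩, hxz⟩
    · rw [hu]
      rintro _ ⟨x, hx, rfl⟩
      exact ⟨_, ⟨x, htK x hx, rfl⟩, fun a ha => hsub x a ha.1 ha.2⟩

end FineCovers

end EffSpace

/-- The words `⟨a, b⟩` with `a ∈ A` and `b ∈ B`. -/
def pairSet (A B : Set (Word k)) : Set (Word k) := Set.image2 (fun a b => tuple [a, b]) A B

/-- The left-nested tuple `⟨…⟨⟨u₁, u₂⟩, u₃⟩, …, uₙ⟩`, which is the base notation of the finite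
products. -/
def leftTuple (us : List (Word k)) : Word k :=
  us.tail.foldl (fun a b => tuple [a, b]) us.headI

/-- The lists of `n` words. -/
def listsOfLength (n : ℕ) : Set (List (Word k)) := {us | us.length = n}

theorem leftTuple_concat {us : List (Word k)} (h : us ≠ []) (b : Word k) :
    leftTuple (us ++ [b]) = tuple [leftTuple us, b] := by
  cases us with
  | nil => exact absurd rfl h
  | cons a us => simp [leftTuple]

theorem leftTuple_concat_of_mem {n : ℕ} {us : List (Word k)} (h : us ∈ listsOfLength (n + 1))
    (b : Word k) : leftTuple (us ++ [b]) = tuple [leftTuple us, b] :=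
  leftTuple_concat (List.ne_nil_of_length_eq_add_one h) b

theorem mem_listsOfLength_succ {n : ℕ} {us : List (Word k)} :
    us ∈ listsOfLength (n + 1) ↔ ∃ vs ∈ listsOfLength n, ∃ b, us = vs ++ [b] := by
  constructor
  · intro h
    obtain rfl | ⟨vs, b, rfl⟩ := List.eq_nil_or_concat' us
    · exact absurd h (Nat.succ_ne_zero n).symm
    · exact ⟨vs, by simpa [listsOfLength] using h, b, rfl⟩
  · rintro ⟨vs, hvs, b, rfl⟩
    simpa [listsOfLength] using hvs

theorem positions_listsOfLength {n : ℕ} :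
    positions (listsOfLength n : Set (List (Word k))) = Set.Iio n := by
  ext i
  constructor
  · rintro ⟨us, rfl, hi⟩
    exact hi
  · exact fun hi => ⟨List.replicate n [], List.length_replicate, by simpa using Set.mem_Iio.1 hi⟩

theorem injOn_leftTuple (n : ℕ) :
    Set.InjOn leftTuple (listsOfLength (n + 1) : Set (List (Word k))) := by
  induction n with
  | zero =>
    intro us hus vs hvs h
    obtain ⟨a, rfl⟩ := List.length_eq_one_iff.1 hus
    obtain ⟨b, rfl⟩ := List.length_eq_one_iff.1 hvs
    exact congrArg (fun w => [w]) h
  | succ n ih =>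
    intro us hus vs hvs h
    obtain ⟨us, hus', a, rfl⟩ := mem_listsOfLength_succ.1 hus
    obtain ⟨vs, hvs', b, rfl⟩ := mem_listsOfLength_succ.1 hvs
    rw [leftTuple_concat_of_mem hus', leftTuple_concat_of_mem hvs'] at h
    obtain ⟨hinit, rfl⟩ : leftTuple us = leftTuple vs ∧ a = b := by
      simpa using tuple_injective h
    rw [ih hus' hvs' hinit]

theorem concat_mem_listProd {A : ℕ → Set (Word k)} {us : List (Word k)} {b : Word k} :
    us ++ [b] ∈ listProd A ↔ us ∈ listProd A ∧ b ∈ A us.length := by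
  constructor
  · refine fun h => ⟨fun i a ha => h i a ?_, h us.length b (by simp)⟩
    rw [List.getElem?_append_left (List.getElem?_eq_some_iff.1 ha).1, ha]
  · rintro ⟨hus, hb⟩ i a ha
    obtain hi | rfl | hi := lt_trichotomy i us.length
    · exact hus i a (by rwa [List.getElem?_append_left hi] at ha)
    · rw [List.getElem?_concat_length, Option.some_inj] at ha
      exact ha ▸ hb
    · simp [List.getElem?_eq_none (l := us ++ [b]) (by simpa using hi)] at ha

theorem box_leftTuple_one (A : ℕ → Set (Word k)) :
    box leftTuple (listsOfLength 1) A = A 0 := by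
  ext v
  constructor
  · rintro ⟨us, ⟨hlen, hus⟩, rfl⟩
    obtain ⟨a, rfl⟩ := List.length_eq_one_iff.1 hlen
    exact hus 0 a rfl
  · exact fun hv => ⟨[v], ⟨rfl, concat_mem_listProd (us := []).2 ⟨by simp [listProd], hv⟩⟩, rfl⟩

theorem box_leftTuple_succ (A : ℕ → Set (Word k)) (n : ℕ) :
    box leftTuple (listsOfLength (n + 2)) A =
      pairSet (box leftTuple (listsOfLength (n + 1)) A) (A (n + 1)) := by
  ext v
  constructor
  · rintro ⟨_, ⟨hlen', hus'⟩, rfl⟩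
    obtain ⟨us, hlen, b, rfl⟩ := mem_listsOfLength_succ.1 hlen'
    obtain ⟨hus, hb⟩ := concat_mem_listProd.1 hus'
    exact ⟨leftTuple us, ⟨us, ⟨hlen, hus⟩, rfl⟩, b, hlen ▸ hb,
      (leftTuple_concat_of_mem hlen b).symm⟩
  · rintro ⟨_, ⟨us, ⟨hlen, hus⟩, rfl⟩, b, hb, rfl⟩
    exact ⟨us ++ [b], ⟨mem_listsOfLength_succ.2 ⟨us, hlen, b, rfl⟩,
      concat_mem_listProd.2 ⟨hus, hlen ▸ hb⟩⟩, leftTuple_concat_of_mem hlen b⟩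

theorem boxes_leftTuple_one (𝒦 : ℕ → Set (Set (Word k))) :
    boxes leftTuple (listsOfLength 1) 𝒦 = 𝒦 0 := by
  ext B
  simp only [boxes, box_leftTuple_one, positions_listsOfLength]
  constructor
  · rintro ⟨T, hT, rfl⟩
    exact hT 0 (Set.mem_Iio.2 one_pos)
  · exact fun hB => ⟨fun _ => B, fun i hi => Nat.lt_one_iff.1 hi ▸ hB, rfl⟩

theorem boxes_leftTuple_succ (𝒦 : ℕ → Set (Set (Word k))) (n : ℕ) :
    boxes leftTuple (listsOfLength (n + 2)) 𝒦 =
      Set.image2 pairSet (boxes leftTuple (listsOfLength (n + 1)) 𝒦) (𝒦 (n + 1)) := by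
  ext B
  constructor
  · rintro ⟨T, hT, rfl⟩
    rw [positions_listsOfLength] at hT
    refine ⟨_, ⟨T, ?_, rfl⟩, T (n + 1), hT (n + 1) (Nat.lt_succ_self _),
      (box_leftTuple_succ T n).symm⟩
    rw [positions_listsOfLength]
    exact fun i hi => hT i (Nat.lt_succ_of_lt hi)
  · rintro ⟨_, ⟨T, hT, rfl⟩, U, hU, rfl⟩
    rw [positions_listsOfLength] at hT
    refine ⟨Function.update T (n + 1) U, ?_, ?_⟩
    · rw [positions_listsOfLength]
      intro i hi
      obtain rfl | hi := Nat.lt_succ_iff_lt_or_eq.1 hi |>.symm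
      · rwa [Function.update_self]
      · rw [Function.update_of_ne hi.ne]
        exact hT i hi
    · rw [box_leftTuple_succ, Function.update_self]
      congr 1
      refine box_congr fun i hi => (Function.update_of_ne ?_ _ _).symm
      rw [positions_listsOfLength] at hi
      exact (Set.mem_Iio.1 hi).ne

theorem positions_setOf_ne_nil : positions {us : List (Word k) | us ≠ []} = Set.univ :=
  Set.eq_univ_of_forall fun i => ⟨List.replicate (i + 1) [], by simp, by simp⟩

namespace EffSpace

theorem traces_prodCompacts (X : EffSpace.{u} k) (Y : EffSpace.{v} k)
    (K : Compacts X × Compacts Y) :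
    (X.prod Y).traces (prodCompacts X Y K) =
      Set.image2 pairSet (X.traces K.1) (Y.traces K.2) := by
  have htrace (x : X) (y : Y) : {w | (x, y) ∈ prodNu X Y w} =
      pairSet {a | x ∈ X.nu a} {b | y ∈ Y.nu b} := by
    ext w
    exact ⟨fun ⟨a, b, hw, ha, hb⟩ => ⟨a, ha, b, hb, hw.symm⟩,
      fun ⟨a, ha, b, hb, hw⟩ => ⟨a, b, hw.symm, ha, hb⟩⟩
  rw [traces, traces, traces, Set.image2_image_left, Set.image2_image_right, ← Set.image_prod]
  exact Set.image_congr fun z _ => htrace z.1 z.2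

theorem dom_prod (X : EffSpace.{u} k) (Y : EffSpace.{v} k) :
    (X.prod Y).dom = pairSet X.dom Y.dom := by
  ext w
  exact ⟨fun ⟨a, ha, b, hb, hw⟩ => ⟨a, ha, b, hb, hw.symm⟩,
    fun ⟨a, ha, b, hb, hw⟩ => ⟨a, ha, b, hb, hw.symm⟩⟩

theorem dom_finProd (X : ℕ → EffSpace.{u} k) (n : ℕ) :
    (finProd X n).dom = box leftTuple (listsOfLength (n + 1)) fun i => (X i).dom := by
  induction n with
  | zero => exact (box_leftTuple_one fun i => (X i).dom).symm
  | succ n ih => rw [box_leftTuple_succ, ← ih, ← dom_prod]; rfl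

theorem traces_finProdCompacts (X : ℕ → EffSpace.{u} k) {n : ℕ}
    (K : ∀ i : Fin (n + 1), Compacts (X i)) {𝒦 : ℕ → Set (Set (Word k))}
    (h : ∀ i : Fin (n + 1), 𝒦 i = (X i).traces (K i)) :
    (finProd X n).traces (finProdCompacts X n K) =
      boxes leftTuple (listsOfLength (n + 1)) 𝒦 := by
  induction n with
  | zero => exact (h 0).symm.trans (boxes_leftTuple_one 𝒦).symm
  | succ n ih =>
    rw [boxes_leftTuple_succ, ← ih (fun i => K i.castSucc) fun i => h i.castSucc,
      show 𝒦 (n + 1) = _ from h (Fin.last (n + 1))]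
    exact traces_prodCompacts (finProd X n) (X (n + 1)) _

theorem dom_countProd (X : ℕ → EffSpace.{u} k) :
    (countProd X).dom = box tuple {us | us ≠ []} fun i => (X i).dom := by
  ext w
  constructor
  · rintro ⟨us, hne, rfl, h⟩
    refine ⟨us, ⟨hne, fun i a ha => ?_⟩, rfl⟩
    obtain ⟨hi, rfl⟩ := List.getElem?_eq_some_iff.1 ha
    exact h i hi
  · rintro ⟨us, ⟨hne, h⟩, rfl⟩
    exact ⟨us, hne, rfl, fun i hi => h i _ (List.getElem?_eq_getElem hi)⟩

theorem traces_countProdCompacts (X : ℕ → EffSpace.{u} k) (K : ∀ i, Compacts (X i)) :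
    (countProd X).traces (countProdCompacts X K) =
      boxes tuple {us | us ≠ []} fun i => (X i).traces (K i) := by
  have htrace (z : ∀ i, X i) : {w | z ∈ countNu X w} =
      box tuple {us | us ≠ []} fun i => {a | z i ∈ (X i).nu a} := by
    ext w
    constructor
    · rintro ⟨us, hne, rfl, h⟩
      refine ⟨us, ⟨hne, fun i a ha => ?_⟩, rfl⟩
      obtain ⟨hi, rfl⟩ := List.getElem?_eq_some_iff.1 ha
      exact h i hi
    · rintro ⟨us, ⟨hne, h⟩, rfl⟩
      exact ⟨us, hne, rfl, fun i hi => h i _ (List.getElem?_eq_getElem hi)⟩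
  rw [boxes, positions_setOf_ne_nil]
  ext B
  constructor
  · rintro ⟨z, hz, rfl⟩
    exact ⟨_, fun i hi => ⟨z i, hz i hi, rfl⟩, htrace z⟩
  · rintro ⟨T, hT, rfl⟩
    choose z hz hzT using fun i => hT i (Set.mem_univ i)
    exact ⟨z, fun i _ => hz i, (htrace z).trans (box_congr fun i _ => hzT i)⟩

end EffSpace

end Traces

/-! ## Machines on words and primitive recursive tests -/

section WordMachines

namespace Type2Machine

variable {k m : ℕ}

/-- One step of a machine with one input tape on the input word `w`, acting on the storage content,
the head position and the output word. -/
def stepOn (M : Type2Machine k 1) (w : Word k) (c : M.Mem × ℕ × Word k) : M.Mem × ℕ × Word k :=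
  let r := M.step c.1 fun _ => w[c.2.1]?
  (r.1, bif r.2.1 0 then c.2.1 + 1 else c.2.1, c.2.2 ++ r.2.2.toList)

/-- The storage content, head position and output word after `t` steps on the input word `w`. -/
def run (M : Type2Machine k 1) (w : Word k) : ℕ → M.Mem × ℕ × Word k
  | 0 => (M.start, 0, [])
  | t + 1 => M.stepOn w (M.run w t)

theorem config_wordTape (M : Type2Machine k 1) (w : Word k) (t : ℕ) :
    M.config ![wordTape w] t = ⟨(M.run w t).1, fun _ => (M.run w t).2.1, (M.run w t).2.2⟩ := by
  induction t with
  | zero => rfl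
  | succ t ih =>
    have hinput : (fun i : Fin 1 => ![wordTape w] i (M.run w t).2.1) =
        fun _ => w[(M.run w t).2.1]? :=
      funext fun i => by rw [Subsingleton.elim i 0]; rfl
    rw [config, ih]
    simp only [hinput, run, stepOn, cond_eq_ite, Config.mk.injEq, true_and, and_true]
    exact funext fun i => by rw [Subsingleton.elim i 0]

theorem computable_stepOn (M : Type2Machine k 1) :
    letI := M.primcodable
    Computable fun p : Word k × M.Mem × ℕ × Word k => M.stepOn p.1 p.2 := by
  let := M.primcodable
  have hsymbol : Computable fun p : Word k × M.Mem × ℕ × Word k =>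
      (fun _ => p.1[p.2.2.1]? : Fin 1 → Option (Letter k)) :=
    (Primrec.dom_finite fun (o : Option (Letter k)) (_ : Fin 1) => o).to_comp.comp
      (Primrec.to_comp (by fun_prop))
  have hstep : Computable fun p : Word k × M.Mem × ℕ × Word k =>
      M.step p.2.1 fun _ => p.1[p.2.2.1]? :=
    M.step_computable.comp (Primrec.to_comp (by fun_prop)) hsymbol
  have hposition : Computable fun p : Word k × M.Mem × ℕ × Word k => p.2.2.1 :=
    Primrec.to_comp (by fun_prop)
  have hmove : Computable fun p : Word k × M.Mem × ℕ × Word k =>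
      (M.step p.2.1 fun _ => p.1[p.2.2.1]?).2.1 0 :=
    (Primrec.dom_finite fun f : Fin 1 → Bool => f 0).to_comp.comp
      (Computable.fst.comp (Computable.snd.comp hstep))
  have hwrite : Computable fun p : Word k × M.Mem × ℕ × Word k =>
      (M.step p.2.1 fun _ => p.1[p.2.2.1]?).2.2.toList :=
    Primrec.optionToList.to_comp.comp (Computable.snd.comp (Computable.snd.comp hstep))
  exact (Computable.fst.comp hstep).pair
    ((Computable.cond hmove (Computable.succ.comp hposition) hposition).pair
      (Computable.list_append.comp (Primrec.to_comp (by fun_prop)) hwrite))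

theorem computable_run (M : Type2Machine k 1) :
    letI := M.primcodable
    Computable fun p : Word k × ℕ => M.run p.1 p.2 := by
  let := M.primcodable
  have hstep : Computable fun q : (Word k × ℕ) × ℕ × M.Mem × ℕ × Word k =>
      M.stepOn q.1.1 q.2.2 :=
    M.computable_stepOn.comp (f := fun p : Word k × M.Mem × ℕ × Word k => M.stepOn p.1 p.2)
      (g := fun q : (Word k × ℕ) × ℕ × M.Mem × ℕ × Word k => (q.1.1, q.2.2))
      (Primrec.to_comp (by fun_prop))
  refine (Computable.nat_rec Computable.snd (Computable.const (M.start, 0, []))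
    hstep.to₂).of_eq fun p => ?_
  induction p.2 with
  | zero => rfl
  | succ t ih => exact congrArg (M.stepOn p.1) ih

theorem out_prefix_out (M : Type2Machine k m) (y : Fin m → InTape k) {s t : ℕ} (h : s ≤ t) :
    (M.config y s).out <+: (M.config y t).out := by
  induction h with
  | refl => exact List.prefix_rfl
  | step _ ih => exact ih.trans (List.prefix_append _ _)

theorem Computes.apply_eq_iff {M : Type2Machine k m} {y : Fin m → InTape k} {q : OmegaWord k}
    (h : M.Computes y q) (n : ℕ) (c : Letter k) :
    q n = c ↔ ∃ t, (M.config y t).out[n]? = some c := by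
  refine ⟨fun hc => hc ▸ h n, fun ⟨t, ht⟩ => ?_⟩
  obtain ⟨s, hs⟩ := h n
  have agree {l l' : Word k} (hl : l <+: l') {a b : Letter k} (ha : l[n]? = some a)
      (hb : l'[n]? = some b) : a = b := by
    obtain ⟨r, rfl⟩ := hl
    rw [List.getElem?_append_left (List.getElem?_eq_some_iff.1 ha).1, ha] at hb
    exact Option.some_injective _ hb
  obtain hst | hts := le_total s t
  · exact agree (M.out_prefix_out y hst) hs ht
  · exact (agree (M.out_prefix_out y hts) ht hs).symm

end Type2Machine

theorem computable_decide_eq {α β : Type*} [Primcodable α] [Primcodable β] [DecidableEq β]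
    {f g : α → β} (hf : Computable f) (hg : Computable g) :
    Computable fun a => decide (f a = g a) :=
  Computable₂.comp Primrec.eq.decide.to_comp hf hg

theorem WordComputable.rePred {k : ℕ} {α : Type*} [Primcodable α] {g : Word k →. OmegaWord k}
    (hg : WordComputable g) {f : α → Word k} (hf : Primrec f) {q : α → OmegaWord k}
    (hq : ∀ a, q a ∈ g (f a)) :
    REPred fun p : α × ℕ × Letter k => q p.1 p.2.1 = p.2.2 := by
  obtain ⟨M, hM⟩ := hg
  let := M.primcodable
  have hout : Computable fun p : (α × ℕ × Letter k) × ℕ => (M.run (f p.1.1) p.2).2.2 :=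
    Computable.snd.comp (Computable.snd.comp (M.computable_run.comp
      (f := fun p : Word k × ℕ => M.run p.1 p.2)
      (g := fun p : (α × ℕ × Letter k) × ℕ => (f p.1.1, p.2)) (Primrec.to_comp (by fun_prop))))
  have hsymbol : Computable fun p : (α × ℕ × Letter k) × ℕ =>
      (M.run (f p.1.1) p.2).2.2[p.1.2.1]? :=
    Computable.list_getElem?.comp hout (Primrec.to_comp (by fun_prop))
  have htest : Computable fun p : (α × ℕ × Letter k) × ℕ =>
      decide ((M.run (f p.1.1) p.2).2.2[p.1.2.1]? = some p.1.2.2) :=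
    computable_decide_eq hsymbol (Primrec.to_comp (by fun_prop))
  refine (rePred_exists_of_computable htest).of_eq fun p => ?_
  rw [((hM _ _).1 (hq p.1)).apply_eq_iff]
  simp only [Type2Machine.config_wordTape, decide_eq_true_eq]

end WordMachines

section REIntersection

variable {k : ℕ}

theorem seqTuple_mul_add {n : ℕ} (p : Fin (n + 1) → OmegaWord k) (i : Fin (n + 1)) (j : ℕ) :
    seqTuple p ((n + 1) * j + i) = p i j := by
  have hmod : ((n + 1) * j + i) % (n + 1) = i := by
    rw [Nat.mul_add_mod, Nat.mod_eq_of_lt i.2]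
  have hdiv : ((n + 1) * j + i) / (n + 1) = j := by
    rw [Nat.mul_add_div n.succ_pos, Nat.div_eq_of_lt i.2, Nat.add_zero]
  simp only [seqTuple, hmod, hdiv]

namespace EffSpace

/-- Some recursively enumerable set of triples realizes intersection in `X`. -/
def HasREIntersection (X : EffSpace.{u} k) : Prop :=
  ∃ S : Set (Word k × Word k × Word k), REPred (fun t => t ∈ S) ∧ X.Intersects S

/-- Intersection in the spaces `X i` is realized by sets of triples that are recursively enumerable
uniformly in `i`. -/
def HasUniformREIntersection (X : ℕ → EffSpace.{u} k) : Prop :=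
  ∃ S : ℕ → Set (Word k × Word k × Word k),
    REPred (fun t : ℕ × Word k × Word k × Word k => t.2 ∈ S t.1) ∧ ∀ i, (X i).Intersects (S i)

theorem enumeratesTriples_iff {s : OmegaWord k} {S : Set (Word k × Word k × Word k)} :
    EnumeratesTriples s S → ∀ a b c, InSeq (tuple [a, b, c]) s ↔ (a, b, c) ∈ S := by
  refine fun h a b c => (h _).trans ⟨?_, fun hS => ⟨a, b, c, hS, rfl⟩⟩
  rintro ⟨a', b', c', hS, he⟩
  obtain ⟨rfl, rfl, rfl⟩ : a = a' ∧ b = b' ∧ c = c' := by simpa using tuple_injective he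
  exact hS

theorem ComputableSequence.hasUniformREIntersection {X : ℕ → EffSpace.{u} k}
    (hX : ComputableSequence X) : HasUniformREIntersection X := by
  obtain ⟨g, hg, h⟩ := hX
  choose q hq r s hqrs _ S hS hXS using h
  refine ⟨S, ?_, hXS⟩
  have hsq (i j : ℕ) : s i j = q i (2 * j + 1) := by
    rw [hqrs]
    exact (seqTuple_mul_add ![r i, s i] 1 j).symm
  have hsymbol : OracleSemidec fun (p : (ℕ × Word k × Word k × Word k) × ℕ × Letter k)
      (_ : ℕ → Unit) => s p.1.1 p.2.1 = p.2.2 :=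
    ((OracleSemidec.of_rePred (hg.rePred (f := fun i : ℕ => unary (i + 1)) (by fun_prop) hq)).comp
      (f := fun p : (ℕ × Word k × Word k × Word k) × ℕ × Letter k =>
        (p.1.1, 2 * p.2.1 + 1, p.2.2)) (by fun_prop)).of_iff fun p _ => by rw [hsq]
  have htriple : OracleSemidec fun (p : ℕ × Word k × Word k × Word k) (_ : ℕ → Unit) =>
      InSeq (tuple [p.2.1, p.2.2.1, p.2.2.2]) (s p.1) :=
    OracleSemidec.inSeq (f := fun p : ℕ × Word k × Word k × Word k =>
      tuple [p.2.1, p.2.2.1, p.2.2.2]) (p := fun p _ => s p.1) (by fun_prop) hsymbol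
  exact (htriple.rePred (Primrec.const ())).of_eq fun p => enumeratesTriples_iff (hS p.1) _ _ _

end EffSpace

end REIntersection

/-! ## Names of products -/

section ProductNames

variable {k m : ℕ} {α β : Type*} [Primcodable α] [Primcodable β]

theorem OracleSemidec.formalSub {S : ℕ → Set (Word k × Word k × Word k)}
    (hS : REPred fun t : ℕ × Word k × Word k × Word k => t.2 ∈ S t.1) :
    OracleSemidec fun (p : ℕ × Word k × Word k) (_ : ℕ → β) => FormalSub (S p.1) p.2.1 p.2.2 := by
  have hmem := of_rePred (β := β) hS
  have hstep : OracleSemidec fun (p : ℕ × Word k × Word k) (_ : ℕ → β) =>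
      ∃ b, (p.2.2, b, p.2.1) ∈ S p.1 ∨ (b, p.2.2, p.2.1) ∈ S p.1 :=
    ex (or
      (hmem.comp (f := fun q : (ℕ × Word k × Word k) × Word k =>
        (q.1.1, q.1.2.2, q.2, q.1.2.1)) (by fun_prop))
      (hmem.comp (f := fun q : (ℕ × Word k × Word k) × Word k =>
        (q.1.1, q.2, q.1.2.2, q.1.2.1)) (by fun_prop)))
  exact reflTransGen (R := fun i c a (_ : ℕ → β) => ∃ b, (a, b, c) ∈ S i ∨ (b, a, c) ∈ S i) hstep

theorem OracleSemidec.symbol_eq (s : Fin m) {f : α → ℕ} (hf : Primrec f) (a : Option (Letter k)) :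
    OracleSemidec fun x (y : ℕ → Fin m → Option (Letter k)) => y (f x) s = a := by
  have happ : Primrec fun p : α × (Fin m → Option (Letter k)) => p.2 s :=
    Primrec.fin_app.comp Primrec.snd (Primrec.const s)
  exact (query (R := fun _ b => decide (b s = a)) hf (by fun_prop)).of_iff fun x y => by
    rw [decide_eq_true_eq]

/-- The sequence on the tape `s`, where `0` stands for a blank. -/
def tapeSeq (y : ℕ → Fin m → Option (Letter k)) (s : Fin m) : OmegaWord k :=
  fun t => (y t s).getD 0

theorem OracleSemidec.inSeq_tapeSeq (s : Fin m) {f : α → Word k} (hf : Primrec f) {g : α → ℕ → ℕ}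
    (hg : Primrec fun p : α × ℕ => g p.1 p.2) :
    OracleSemidec fun x (y : ℕ → Fin m → Option (Letter k)) =>
      InSeq (f x) fun j => tapeSeq y s (g x j) := by
  have happ : Primrec fun p : (α × ℕ × Letter k) × (Fin m → Option (Letter k)) => p.2 s :=
    Primrec.fin_app.comp Primrec.snd (Primrec.const s)
  have hposition : Primrec fun p : α × ℕ × Letter k => g p.1 p.2.1 :=
    hg.comp (f := fun p : α × ℕ => g p.1 p.2) (g := fun p : α × ℕ × Letter k => (p.1, p.2.1))
      (by fun_prop)
  have hsymbol : OracleSemidec fun (p : α × ℕ × Letter k) (y : ℕ → Fin m → Option (Letter k)) =>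
      tapeSeq y s (g p.1 p.2.1) = p.2.2 :=
    (query (R := fun (p : α × ℕ × Letter k) b => decide ((b s).getD 0 = p.2.2)) hposition
      (by fun_prop)).of_iff fun p y => by rw [decide_eq_true_eq, tapeSeq]
  exact inSeq hf hsymbol

/-- The words recognized as finite covers of the product of the first `n + 1` factors, for `n ∈ L`,
where the names of the factors are read off the interleaved sequence `p`. The set `L` is `{n}` in
the end, but a machine can only semidecide it. -/
def finProductCovers (L : Set ℕ) (p : OmegaWord k) (S : ℕ → Set (Word k × Word k × Word k)) :
    Set (Word k) :=
  productCovers leftTuple {us | ∃ n ∈ L, us ∈ listsOfLength (n + 1)}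
    (fun i => {w | ∃ n ∈ L, InSeq w fun j => p ((n + 1) * j + i)}) fun i => FormalSub (S i)

theorem finProductCovers_singleton {n : ℕ} {p : Fin (n + 1) → OmegaWord k} {D : ℕ → Set (Word k)}
    {𝒦 : ℕ → Set (Set (Word k))} {S : ℕ → Set (Word k × Word k × Word k)}
    (hp : ∀ i : Fin (n + 1), listed (p i) = covers (D i) (𝒦 i))
    (h𝒦 : ∀ i : Fin (n + 1), HasFineCovers (D i) (𝒦 i) (FormalSub (S i))) :
    finProductCovers {n} (seqTuple p) S =
      covers (box leftTuple (listsOfLength (n + 1)) D)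
        (boxes leftTuple (listsOfLength (n + 1)) 𝒦) := by
  simp only [finProductCovers, Set.mem_singleton_iff, exists_eq_left, Set.ofPred_mem_eq]
  refine productCovers_eq_covers (injOn_leftTuple n) (fun i hi => ?_) fun i hi => ?_
  all_goals rw [positions_listsOfLength, Set.mem_Iio] at hi
  · exact h𝒦 ⟨i, hi⟩
  · refine Eq.trans ?_ (hp ⟨i, hi⟩)
    exact congrArg listed (funext (seqTuple_mul_add p ⟨i, hi⟩))

theorem OracleSemidec.finProductCovers {L : (ℕ → Fin m → Option (Letter k)) → Set ℕ}
    (hL : OracleSemidec fun n y => n ∈ L y) (s : Fin m)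
    {S : ℕ → Set (Word k × Word k × Word k)}
    (hS : REPred fun t : ℕ × Word k × Word k × Word k => t.2 ∈ S t.1) :
    OracleSemidec fun w y => w ∈ finProductCovers (L y) (tapeSeq y s) S := by
  have hlength : OracleSemidec fun (us : List (Word k)) y =>
      ∃ n ∈ L y, us.length = n + 1 :=
    ex (and (hL.comp (f := fun q : List (Word k) × ℕ => q.2) (by fun_prop))
      (eq (by fun_prop) (by fun_prop)))
  have hnames : OracleSemidec fun (q : ℕ × Word k) y =>
      ∃ n ∈ L y, InSeq q.2 fun j => tapeSeq y s ((n + 1) * j + q.1) :=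
    ex (and (hL.comp (f := fun q : (ℕ × Word k) × ℕ => q.2) (by fun_prop))
      (inSeq_tapeSeq s (g := fun (q : (ℕ × Word k) × ℕ) j => (q.2 + 1) * j + q.1.1)
        (by fun_prop) (by fun_prop)))
  have hleft : Primrec (leftTuple : List (Word k) → Word k) := by
    unfold leftTuple
    fun_prop
  exact productCovers hleft hlength hnames (formalSub hS)

theorem rePred_mem_ite_zero {S₁ S₂ : Set α} (h₁ : REPred fun a => a ∈ S₁)
    (h₂ : REPred fun a => a ∈ S₂) :
    REPred fun t : ℕ × α => t.2 ∈ if t.1 = 0 then S₁ else S₂ := by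
  have hcases : OracleSemidec fun (t : ℕ × α) (_ : ℕ → Unit) =>
      t.1 = 0 ∧ t.2 ∈ S₁ ∨ 0 < t.1 ∧ t.2 ∈ S₂ :=
    .or (.and (.eq Primrec.fst (Primrec.const 0)) ((OracleSemidec.of_rePred h₁).comp Primrec.snd))
      (.and (.lt (Primrec.const 0) Primrec.fst) ((OracleSemidec.of_rePred h₂).comp Primrec.snd))
  refine (hcases.rePred (Primrec.const ())).of_eq fun t => ?_
  obtain h | h := Nat.eq_zero_or_pos t.1
  · simp [h]
  · simp [h, h.ne']

theorem exists_seqComputable_listed_pair {S₁ S₂ : Set (Word k × Word k × Word k)}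
    (h₁ : REPred fun t => t ∈ S₁) (h₂ : REPred fun t => t ∈ S₂) :
    ∃ g : OmegaWord k →. OmegaWord k, SeqComputable g ∧
      ∀ (p₁ p₂ : OmegaWord k) (D₁ D₂ : Set (Word k)) (𝒦₁ 𝒦₂ : Set (Set (Word k))),
        listed p₁ = covers D₁ 𝒦₁ → listed p₂ = covers D₂ 𝒦₂ →
        HasFineCovers D₁ 𝒦₁ (FormalSub S₁) → HasFineCovers D₂ 𝒦₂ (FormalSub S₂) →
        ∃ q ∈ g (seqTuple ![p₁, p₂]),
          listed q = covers (pairSet D₁ D₂) (Set.image2 pairSet 𝒦₁ 𝒦₂) := by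
  have hone : OracleSemidec fun n (_ : ℕ → Fin 1 → Option (Letter k)) => n ∈ ({1} : Set ℕ) :=
    OracleSemidec.eq Primrec.id (Primrec.const 1)
  obtain ⟨g, hg, hcomp⟩ := (OracleSemidec.finProductCovers hone 0
    (S := fun i => if i = 0 then S₁ else S₂) (rePred_mem_ite_zero h₁ h₂)).exists_seqComputable
  refine ⟨g, hg, fun p₁ p₂ D₁ D₂ 𝒦₁ 𝒦₂ hp₁ hp₂ h𝒦₁ h𝒦₂ => ?_⟩
  obtain ⟨q, hq, hlist⟩ := hcomp (seqTuple ![p₁, p₂])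
  have hcovers := finProductCovers_singleton (p := ![p₁, p₂])
    (D := fun i => if i = 0 then D₁ else D₂) (𝒦 := fun i => if i = 0 then 𝒦₁ else 𝒦₂)
    (S := fun i => if i = 0 then S₁ else S₂) (Fin.forall_fin_two.2 ⟨hp₁, hp₂⟩)
    (Fin.forall_fin_two.2 ⟨h𝒦₁, h𝒦₂⟩)
  rw [box_leftTuple_succ, boxes_leftTuple_succ, box_leftTuple_one, boxes_leftTuple_one] at hcovers
  exact ⟨q, hq, (Set.ext hlist).trans hcovers⟩

theorem exists_wordSeqComputable_listed_finProd {S : ℕ → Set (Word k × Word k × Word k)}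
    (hS : REPred fun t : ℕ × Word k × Word k × Word k => t.2 ∈ S t.1) :
    ∃ f : Word k → OmegaWord k →. OmegaWord k, WordSeqComputable f ∧
      ∀ (n : ℕ) (p : Fin (n + 1) → OmegaWord k) (D : ℕ → Set (Word k))
        (𝒦 : ℕ → Set (Set (Word k))),
        (∀ i : Fin (n + 1), listed (p i) = covers (D i) (𝒦 i)) →
        (∀ i : Fin (n + 1), HasFineCovers (D i) (𝒦 i) (FormalSub (S i))) →
        ∃ q ∈ f (unary (n + 1)) (seqTuple p),
          listed q = covers (box leftTuple (listsOfLength (n + 1)) D)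
            (boxes leftTuple (listsOfLength (n + 1)) 𝒦) := by
  have hlength : OracleSemidec fun n (y : ℕ → Fin 2 → Option (Letter k)) =>
      n ∈ {n | y n 0 = some 0 ∧ y (n + 1) 0 = none} :=
    .and (.symbol_eq 0 (by fun_prop) _) (.symbol_eq 0 (by fun_prop) _)
  obtain ⟨f, hf, hcomp⟩ := (OracleSemidec.finProductCovers hlength 1 hS).exists_wordSeqComputable
  refine ⟨f, hf, fun n p D 𝒦 hp h𝒦 => ?_⟩
  obtain ⟨q, hq, hlist⟩ := hcomp (unary (n + 1)) (seqTuple p)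
  refine ⟨q, hq, (Set.ext hlist).trans ?_⟩
  have hn : {l | (unary (n + 1) : Word k)[l]? = some 0 ∧ (unary (n + 1) : Word k)[l + 1]? = none} =
      {n} := by
    ext l
    simp only [unary, List.getElem?_replicate, Set.mem_ofPred_eq, Set.mem_singleton_iff]
    grind
  exact (congrArg (fun L => finProductCovers L (seqTuple p) S) hn).trans
    (finProductCovers_singleton hp h𝒦)

theorem exists_seqComputable_listed_countProd {S : ℕ → Set (Word k × Word k × Word k)}
    (hS : REPred fun t : ℕ × Word k × Word k × Word k => t.2 ∈ S t.1) :
    ∃ g : OmegaWord k →. OmegaWord k, SeqComputable g ∧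
      ∀ (p : ℕ → OmegaWord k) (r : OmegaWord k) (D : ℕ → Set (Word k))
        (𝒦 : ℕ → Set (Set (Word k))), IsSeqSeq p r →
        (∀ i, listed (p i) = covers (D i) (𝒦 i)) →
        (∀ i, HasFineCovers (D i) (𝒦 i) (FormalSub (S i))) →
        ∃ q ∈ g r, listed q = covers (box tuple {us | us ≠ []} D)
          (boxes tuple {us | us ≠ []} 𝒦) := by
  have hne : OracleSemidec fun (us : List (Word k)) (_ : ℕ → Fin 1 → Option (Letter k)) =>
      us ∈ {us | us ≠ []} :=
    (OracleSemidec.lt (f := fun _ => 0) (g := List.length) (by fun_prop) (by fun_prop)).of_iff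
      fun _ _ => List.length_pos_iff.symm
  have hnames : OracleSemidec fun (q : ℕ × Word k) (y : ℕ → Fin 1 → Option (Letter k)) =>
      q.2 ∈ listed fun j => tapeSeq y 0 (cantorPair q.1 j) :=
    .inSeq_tapeSeq 0 (g := fun (q : ℕ × Word k) j => cantorPair q.1 j) (by fun_prop)
      (by unfold cantorPair; fun_prop)
  obtain ⟨g, hg, hcomp⟩ := (OracleSemidec.productCovers (c := tuple) (by fun_prop) hne
    (E := fun y i => listed fun j => tapeSeq y 0 (cantorPair i j)) hnames
    (Sub := fun _ i => FormalSub (S i)) (.formalSub hS)).exists_seqComputable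
  refine ⟨g, hg, fun p r D 𝒦 hr hp h𝒦 => ?_⟩
  obtain ⟨q, hq, hlist⟩ := hcomp r
  refine ⟨q, hq, (Set.ext hlist).trans (productCovers_eq_covers
    (fun _ _ _ _ h => tuple_injective h) (fun i _ => h𝒦 i) fun i _ => ?_)⟩
  exact (congrArg listed (funext (hr i))).trans (hp i)

end ProductNames

namespace EffSpace

variable {k : ℕ}

theorem sUnion_image2_pairSet (𝒦 𝒦' : Set (Set (Word k))) :
    ⋃₀ Set.image2 pairSet 𝒦 𝒦' = pairSet (⋃₀ 𝒦) (⋃₀ 𝒦') := by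
  ext v
  constructor
  · rintro ⟨_, ⟨T, hT, U, hU, rfl⟩, a, ha, b, hb, rfl⟩
    exact ⟨a, ⟨T, hT, ha⟩, b, ⟨U, hU, hb⟩, rfl⟩
  · rintro ⟨a, ⟨T, hT, ha⟩, b, ⟨U, hU, hb⟩, rfl⟩
    exact ⟨_, ⟨T, hT, U, hU, rfl⟩, a, ha, b, hb, rfl⟩

theorem HasREIntersection.repComputable_prodCompacts {X : EffSpace.{u} k} {Y : EffSpace.{v} k}
    (hX : X.HasREIntersection) (hY : Y.HasREIntersection) :
    RepComputable (X.kappa.prod Y.kappa) (X.prod Y).kappa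
        (prodCompacts X Y : Compacts X × Compacts Y →. Compacts (X.prod Y)) ∧
      RepComputable (X.kappaMin.prod Y.kappaMin) (X.prod Y).kappaMin
        (prodCompacts X Y : Compacts X × Compacts Y →. Compacts (X.prod Y)) := by
  obtain ⟨S₁, h₁, hS₁⟩ := hX
  obtain ⟨S₂, h₂, hS₂⟩ := hY
  obtain ⟨g, hg, H⟩ := exists_seqComputable_listed_pair h₁ h₂
  refine ⟨⟨g, hg, ?_⟩, ⟨g, hg, ?_⟩⟩ <;> rintro _ K ⟨p, p', rfl, hp, hp'⟩ L hL <;>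
    rw [PFun.coe_val, Part.mem_some_iff] at hL <;> subst hL
  · obtain ⟨q, hq, hlist⟩ := H p p' _ _ _ _ (X.kappa_iff.1 hp) (Y.kappa_iff.1 hp')
      (X.hasFineCovers hS₁ K.1.isCompact (X.sUnion_traces_subset _))
      (Y.hasFineCovers hS₂ K.2.isCompact (Y.sUnion_traces_subset _))
    refine ⟨q, hq, (X.prod Y).kappa_iff.2 ?_⟩
    rwa [traces_prodCompacts, dom_prod]
  · obtain ⟨q, hq, hlist⟩ := H p p' _ _ _ _ (X.kappaMin_iff.1 hp) (Y.kappaMin_iff.1 hp')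
      (X.hasFineCovers hS₁ K.1.isCompact subset_rfl)
      (Y.hasFineCovers hS₂ K.2.isCompact subset_rfl)
    refine ⟨q, hq, (X.prod Y).kappaMin_iff.2 ?_⟩
    rwa [traces_prodCompacts, sUnion_image2_pairSet]

theorem exists_eq_traces (X : ℕ → EffSpace.{u} k) {n : ℕ}
    (K : ∀ i : Fin (n + 1), Compacts (X i)) :
    ∃ 𝒦 : ℕ → Set (Set (Word k)), ∀ i : Fin (n + 1), 𝒦 i = (X i).traces (K i) :=
  ⟨fun i => if h : i < n + 1 then (X i).traces (K ⟨i, h⟩) else ∅, fun i => dif_pos i.2⟩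

theorem HasUniformREIntersection.exists_realizes_finProdCompacts {X : ℕ → EffSpace.{u} k}
    (hX : HasUniformREIntersection X) :
    ∃ f : Word k → OmegaWord k →. OmegaWord k, WordSeqComputable f ∧ ∀ n : ℕ,
      Realizes (f (unary (n + 1)))
        (MultiRep.finProd fun i : Fin (n + 1) => (X i).kappa) (finProd X n).kappa
        (finProdCompacts X n : (∀ i : Fin (n + 1), Compacts (X i)) →. Compacts (finProd X n)) ∧
      Realizes (f (unary (n + 1)))
        (MultiRep.finProd fun i : Fin (n + 1) => (X i).kappaMin) (finProd X n).kappaMin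
        (finProdCompacts X n : (∀ i : Fin (n + 1), Compacts (X i)) →. Compacts (finProd X n)) := by
  obtain ⟨S, hS, hXS⟩ := hX
  obtain ⟨f, hf, H⟩ := exists_wordSeqComputable_listed_finProd hS
  refine ⟨f, hf, fun n => ⟨?_, ?_⟩⟩ <;> rintro _ K ⟨p, rfl, hp⟩ L hL <;>
    rw [PFun.coe_val, Part.mem_some_iff] at hL <;> subst hL <;>
    obtain ⟨𝒦, h𝒦⟩ := exists_eq_traces X K
  · obtain ⟨q, hq, hlist⟩ := H n p (fun i => (X i).dom) 𝒦
      (fun i => (h𝒦 i).symm ▸ (X i).kappa_iff.1 (hp i))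
      (fun i => (h𝒦 i).symm ▸
        (X i).hasFineCovers (hXS i) (K i).isCompact ((X i).sUnion_traces_subset _))
    refine ⟨q, hq, (finProd X n).kappa_iff.2 ?_⟩
    rwa [traces_finProdCompacts X K h𝒦, dom_finProd]
  · obtain ⟨q, hq, hlist⟩ := H n p (fun i => ⋃₀ 𝒦 i) 𝒦
      (fun i => (h𝒦 i).symm ▸ (X i).kappaMin_iff.1 (hp i))
      (fun i => (h𝒦 i).symm ▸ (X i).hasFineCovers (hXS i) (K i).isCompact subset_rfl)
    refine ⟨q, hq, (finProd X n).kappaMin_iff.2 ?_⟩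
    rwa [traces_finProdCompacts X K h𝒦, sUnion_boxes]
    rw [positions_listsOfLength]
    exact fun us hus i hi hle => absurd (hus ▸ hle) (not_le_of_gt hi)

theorem HasUniformREIntersection.repComputable_countProdCompacts {X : ℕ → EffSpace.{u} k}
    (hX : HasUniformREIntersection X) :
    RepComputable (MultiRep.countProd fun i => (X i).kappa) (countProd X).kappa
        (countProdCompacts X : (∀ i, Compacts (X i)) →. Compacts (countProd X)) ∧
      RepComputable (MultiRep.countProd fun i => (X i).kappaMin) (countProd X).kappaMin
        (PFun.res (countProdCompacts X) {K | ∀ i, (K i : Set (X i)).Nonempty}) := by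
  obtain ⟨S, hS, hXS⟩ := hX
  obtain ⟨g, hg, H⟩ := exists_seqComputable_listed_countProd hS
  refine ⟨⟨g, hg, ?_⟩, ⟨g, hg, ?_⟩⟩ <;> rintro r K ⟨p, hr, hp⟩ L hL
  · rw [PFun.coe_val, Part.mem_some_iff] at hL
    subst hL
    obtain ⟨q, hq, hlist⟩ := H p r _ _ hr (fun i => (X i).kappa_iff.1 (hp i)) fun i =>
      (X i).hasFineCovers (hXS i) (K i).isCompact ((X i).sUnion_traces_subset _)
    refine ⟨q, hq, (countProd X).kappa_iff.2 ?_⟩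
    rwa [traces_countProdCompacts, dom_countProd]
  · rw [PFun.mem_res] at hL
    obtain ⟨hK, rfl⟩ := hL
    obtain ⟨q, hq, hlist⟩ := H p r _ _ hr (fun i => (X i).kappaMin_iff.1 (hp i)) fun i =>
      (X i).hasFineCovers (hXS i) (K i).isCompact subset_rfl
    refine ⟨q, hq, (countProd X).kappaMin_iff.2 ?_⟩
    rwa [traces_countProdCompacts, sUnion_boxes]
    exact fun _ _ i _ _ => (hK i).image _

end EffSpace

theorem corollary5_general {k : ℕ}
    (X₁ : EffSpace.{u} k) (X₂ : EffSpace.{v} k)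
    (hX₁ : X₁.HasREIntersection) (hX₂ : X₂.HasREIntersection)
    (X : ℕ → EffSpace.{w} k) (hX : EffSpace.HasUniformREIntersection X) :
    (RepComputable (X₁.kappa.prod X₂.kappa) (X₁.prod X₂).kappa
        (EffSpace.prodCompacts X₁ X₂ : Compacts X₁ × Compacts X₂ →. Compacts (X₁.prod X₂)) ∧
      (∃ f : Word k → OmegaWord k →. OmegaWord k, WordSeqComputable f ∧
        ∀ n : ℕ, Realizes (f (unary (n + 1)))
          (MultiRep.finProd fun i : Fin (n + 1) => (X i).kappa) (EffSpace.finProd X n).kappa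
          (EffSpace.finProdCompacts X n :
            (∀ i : Fin (n + 1), Compacts (X i)) →. Compacts (EffSpace.finProd X n))) ∧
      RepComputable (MultiRep.countProd fun i => (X i).kappa) (EffSpace.countProd X).kappa
        (EffSpace.countProdCompacts X :
          (∀ i, Compacts (X i)) →. Compacts (EffSpace.countProd X))) ∧
    (RepComputable (X₁.kappaMin.prod X₂.kappaMin) (X₁.prod X₂).kappaMin
        (EffSpace.prodCompacts X₁ X₂ : Compacts X₁ × Compacts X₂ →. Compacts (X₁.prod X₂)) ∧
      (∃ f : Word k → OmegaWord k →. OmegaWord k, WordSeqComputable f ∧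
        ∀ n : ℕ, Realizes (f (unary (n + 1)))
          (MultiRep.finProd fun i : Fin (n + 1) => (X i).kappaMin) (EffSpace.finProd X n).kappaMin
          (EffSpace.finProdCompacts X n :
            (∀ i : Fin (n + 1), Compacts (X i)) →. Compacts (EffSpace.finProd X n))) ∧
      RepComputable (MultiRep.countProd fun i => (X i).kappaMin) (EffSpace.countProd X).kappaMin
        (PFun.res (EffSpace.countProdCompacts X) {K | ∀ i, (K i : Set (X i)).Nonempty})) := by
  obtain ⟨hpair, hpairMin⟩ := hX₁.repComputable_prodCompacts hX₂
  obtain ⟨f, hf, hfin⟩ := hX.exists_realizes_finProdCompacts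
  obtain ⟨hcount, hcountMin⟩ := hX.repComputable_countProdCompacts
  exact ⟨⟨hpair, ⟨f, hf, fun n => (hfin n).1⟩, hcount⟩,
    hpairMin, ⟨f, hf, fun n => (hfin n).2⟩, hcountMin⟩

theorem corollary5 {k : ℕ}
    (X₁ : EffSpace.{u} k) (X₂ : EffSpace.{v} k) (hX₁ : X₁.IsComputable) (hX₂ : X₂.IsComputable)
    (X : ℕ → EffSpace.{w} k) (hX : EffSpace.ComputableSequence X) :
    -- products with respect to the multi-representations by finite covers
    (RepComputable (X₁.kappa.prod X₂.kappa) (X₁.prod X₂).kappa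
        (EffSpace.prodCompacts X₁ X₂ : Compacts X₁ × Compacts X₂ →. Compacts (X₁.prod X₂)) ∧
      (∃ f : Word k → OmegaWord k →. OmegaWord k, WordSeqComputable f ∧
        ∀ n : ℕ, Realizes (f (unary (n + 1)))
          (MultiRep.finProd fun i : Fin (n + 1) => (X i).kappa) (EffSpace.finProd X n).kappa
          (EffSpace.finProdCompacts X n :
            (∀ i : Fin (n + 1), Compacts (X i)) →. Compacts (EffSpace.finProd X n))) ∧
      RepComputable (MultiRep.countProd fun i => (X i).kappa) (EffSpace.countProd X).kappa
        (EffSpace.countProdCompacts X :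
          (∀ i, Compacts (X i)) →. Compacts (EffSpace.countProd X))) ∧
    -- products with respect to the multi-representations by minimal finite covers
    (RepComputable (X₁.kappaMin.prod X₂.kappaMin) (X₁.prod X₂).kappaMin
        (EffSpace.prodCompacts X₁ X₂ : Compacts X₁ × Compacts X₂ →. Compacts (X₁.prod X₂)) ∧
      (∃ f : Word k → OmegaWord k →. OmegaWord k, WordSeqComputable f ∧
        ∀ n : ℕ, Realizes (f (unary (n + 1)))
          (MultiRep.finProd fun i : Fin (n + 1) => (X i).kappaMin) (EffSpace.finProd X n).kappaMin
          (EffSpace.finProdCompacts X n :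
            (∀ i : Fin (n + 1), Compacts (X i)) →. Compacts (EffSpace.finProd X n))) ∧
      RepComputable (MultiRep.countProd fun i => (X i).kappaMin) (EffSpace.countProd X).kappaMin
        (PFun.res (EffSpace.countProdCompacts X) {K | ∀ i, (K i : Set (X i)).Nonempty})) :=
  corollary5_general X₁ X₂ hX₁.2 hX₂.2 X hX.hasUniformREIntersection
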